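/- Let $N\ge 1$. Regard $\Gamma_0(N)$ as a subgroup of $SL_2(\mathbb R)$, let $\operatorname{Norm}(\Gamma_0(N))$ be its normalizer in $SL_2(\mathbb R)$ and put $G=\operatorname{Norm}(\Gamma_0(N))/\Gamma_0(N)$. Write $v_p(N)$ for the exponent of the prime $p$ in $N$. For $m\mid N$ with $\gcd(m,N/m)=1$ let $w_m$ be any matrix $\frac1{\sqrt m}\begin{pmatrix} ma& b\\ Nc& md\end{pmatrix}$ of determinant $1$ with $a,b,c,d\in\mathbb Z$ (Atkin–Lehner involution), and for $h\ge1$ let $S_h=\begin{pmatrix}1&1/h\\0&1\end{pmatrix}$. The same letters denote classes in $G$, where they are defined. Let $\lambda=v_2(N)$, $\mu=\min(3,\lfloor\lambda/2\rfloor)$ and $\upsilon''=2^{\mu}$. **Theorem.** For every choice of the Atkin–Lehner matrices, $G$ is the product of the subgroups $F_p$ ($p$ prime, $p\mid N$) described below. Here "product" means an internal, not necessarily direct, product: $F_pF_q=F_qF_p$ for all $p,q$, and, for every ordering $p_1,\dots,p_k$ of the primes dividing $N$, each element of $G$ can be written in exactly one way as $g_1\cdots g_k$ with $g_i\in F_{p_i}$.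 1. For a prime $q\ge5$, $q\mid N$: $F_q=\langle w_{q^{v_q(N)}}\rangle$, of order $2$. 2. The factor $F_3$ at $3$, with $w=w_{3^{v_3(N)}}$: - (a) if $v_3(N)=0$: $F_3=\{1\}$; - (b) if $v_3(N)=1$: $F_3=\langle w_3\rangle$, of order $2$; - (c) if $v_3(N)=2$: $F_3=\langle w_9,S_3\rangle$ has order $12$, with defining relations $w_9^2=S_3^3=(w_9S_3)^3=1$; - (d) if $v_3(N)\ge3$: $F_3=\langle w,S_3\rangle$ has order $18$, with defining relations $w^2=S_3^3=1$ and "$wS_3w$ commutes with $S_3$". 3. The factor $F_2$ at $2$, with $w=w_{2^{\lambda}}$: - (a) if $\lambda=0$: $F_2=\{1\}$; - (b) if $\lambda=1$: $F_2=\langle w_2\rangle$, of order $2$; - (c) if $\lambda=2\mu$ and $2\le\lambda\le6$: $F_2=\langle w,S_{\upsilon''}\rangle$ satisfies $w^2=S_{\upsilon''}^{\upsilon''}=(wS_{\upsilon''})^3=1$ and has order $6$, $24$, $96$ for $\upsilon''=2,4,8$ respectively; for $\lambda=2,4$ these relations are defining relations; - (d) if $\lambda>2\mu$ and $2\le\lambda\le7$: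 $F_2=\langle w,S_{\upsilon''}\rangle$ satisfies $w^2=S_{\upsilon''}^{\upsilon''}=(wS_{\upsilon''})^4=1$; for $\lambda=3$ these relations are defining relations; - (ĉ) if $\lambda=8$: $F_2=\langle w_{256},S_8\rangle$, with defining relations $w_{256}^2=S_8^8=1$ and $w_{256}S_8w_{256}S_8w_{256}S_8^3w_{256}S_8^3=1$; - (c̃, d̃) if $\lambda\ge9$: $F_2=\langle w,S_8\rangle$, with defining relations $w^2=S_8^8=1$ and "$S_8$ commutes with $wS_8w$". -/

import Mathlib

open scoped MatrixGroups Pointwise commutatorElement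

namespace Gamma0Normalizer

/-- `Γ₀(N)`, regarded as a subgroup of `SL₂(ℝ)`. -/
def Gamma0R (N : ℕ) : Subgroup SL(2, ℝ) :=
  (CongruenceSubgroup.Gamma0 N).map (Matrix.SpecialLinearGroup.map (Int.castRingHom ℝ))

/-- The normalizer of `Γ₀(N)` in `SL₂(ℝ)`. -/
abbrev Norm (N : ℕ) : Subgroup SL(2, ℝ) :=
  Subgroup.normalizer (Gamma0R N : Set SL(2, ℝ))

/-- The quotient group `Norm(Γ₀(N)) / Γ₀(N)`. -/
abbrev NormQuot (N : ℕ) : Type :=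
  Norm N ⧸ (Gamma0R N).subgroupOf (Norm N)

/-- `M` is an Atkin–Lehner matrix `w_m` of level `N`: `m ∣ N`, `gcd(m, N/m) = 1` and
`M = (1/√m) [m a, b; N c, m d]` with integers `a, b, c, d` (and determinant one). -/
def IsAtkinLehner (N m : ℕ) (M : SL(2, ℝ)) : Prop :=
  m ∣ N ∧ Nat.Coprime m (N / m) ∧ ∃ a b c d : ℤ,
    (M : Matrix (Fin 2) (Fin 2) ℝ) =
      (1 / Real.sqrt (m : ℝ)) • !![(m : ℝ) * a, (b : ℝ); (N : ℝ) * c, (m : ℝ) * d]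

/-- The translation matrix `S_h = [1, 1/h; 0, 1]`. -/
noncomputable def shift (h : ℕ) : SL(2, ℝ) :=
  ⟨!![1, 1 / (h : ℝ); 0, 1], by simp [Matrix.det_fin_two]⟩

/-- The `p`-part of `v(N)`: it is `2 ^ min(3, ⌊v₂(N)/2⌋)` for `p = 2`,
`3 ^ min(1, ⌊v₃(N)/2⌋)` for `p = 3`, and `1` for all other `p`. -/
def width (N p : ℕ) : ℕ :=
  if p = 2 then 2 ^ min 3 (N.factorization 2 / 2)
  else if p = 3 then 3 ^ min 1 (N.factorization 3 / 2)
  else 1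

theorem mem_Gamma0R_iff {N : ℕ} {M : SL(2, ℝ)} :
    M ∈ Gamma0R N ↔ ∃ a b c d : ℤ,
      (M : Matrix (Fin 2) (Fin 2) ℝ) = !![(a : ℝ), (b : ℝ); (N : ℝ) * c, (d : ℝ)] := by
  constructor
  · rintro ⟨g, hg, rfl⟩
    have h0 : ((g 1 0 : ℤ) : ZMod N) = 0 := CongruenceSubgroup.Gamma0_mem.mp hg
    obtain ⟨c, hc⟩ := (ZMod.intCast_zmod_eq_zero_iff_dvd _ _).mp h0
    refine ⟨g 0 0, g 0 1, c, g 1 1, ?_⟩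
    ext i j
    fin_cases i <;> fin_cases j <;> simp [hc]
  · rintro ⟨a, b, c, d, h⟩
    have hdet : a * d - b * (N * c) = 1 := by
      have h1 : (M : Matrix (Fin 2) (Fin 2) ℝ).det = 1 := M.2
      rw [h, Matrix.det_fin_two_of] at h1
      exact_mod_cast h1
    refine ⟨⟨!![a, b; N * c, d], by rw [Matrix.det_fin_two_of]; exact hdet⟩, ?_, ?_⟩
    · exact CongruenceSubgroup.Gamma0_mem.mpr (by simp)
    · refine Subtype.ext ?_
      change (!![a, b; N * c, d] : Matrix (Fin 2) (Fin 2) ℤ).map (Int.castRingHom ℝ) =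
        (M : Matrix (Fin 2) (Fin 2) ℝ)
      rw [h]
      ext i j
      fin_cases i <;> fin_cases j <;> simp

theorem mem_Norm_of {N : ℕ} {M : SL(2, ℝ)}
    (h₁ : ∀ g ∈ Gamma0R N, M * g * M⁻¹ ∈ Gamma0R N)
    (h₂ : ∀ g ∈ Gamma0R N, M⁻¹ * g * M ∈ Gamma0R N) : M ∈ Norm N := by
  rw [Subgroup.mem_normalizer_iff]
  intro g
  refine ⟨h₁ g, fun hg => ?_⟩
  have := h₂ _ hg
  simpa [mul_assoc] using this

/-- Atkin–Lehner matrices exist for every exact divisor `m` of `N`. -/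
theorem exists_isAtkinLehner {N m : ℕ} [NeZero N] (hm : m ∣ N) (hc : Nat.Coprime m (N / m)) :
    ∃ M : SL(2, ℝ), IsAtkinLehner N m M := by
  obtain ⟨n, hn⟩ := id hm
  have hm0 : 0 < m := Nat.pos_of_dvd_of_pos hm (Nat.pos_of_ne_zero (NeZero.ne N))
  have hc' : Nat.Coprime m n := by rwa [hn, Nat.mul_div_cancel_left n hm0] at hc
  have hb : (m : ℤ) * m.gcdA n + n * m.gcdB n = 1 := by
    rw [← Nat.gcd_eq_gcd_ab, hc']; rfl
  have hbR : (m : ℝ) * m.gcdA n + n * m.gcdB n = 1 := by exact_mod_cast hb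
  have hs : Real.sqrt (m : ℝ) ^ 2 = m := Real.sq_sqrt (by positivity)
  have hs0 : Real.sqrt (m : ℝ) ≠ 0 := (Real.sqrt_pos.mpr (by exact_mod_cast hm0)).ne'
  have hN : (N : ℝ) = m * n := by exact_mod_cast hn
  refine ⟨⟨(1 / Real.sqrt (m : ℝ)) •
    !![(m : ℝ) * (1 : ℤ), ((-m.gcdB n : ℤ) : ℝ); (N : ℝ) * (1 : ℤ), (m : ℝ) * m.gcdA n], ?_⟩,
    hm, hc, 1, -m.gcdB n, 1, m.gcdA n, rfl⟩
  rw [Matrix.det_smul, Matrix.det_fin_two_of, hN, Fintype.card_fin, div_pow, hs]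
  have hmR : (m : ℝ) ≠ 0 := by exact_mod_cast hm0.ne'
  push_cast
  field_simp
  linear_combination hbR

theorem IsAtkinLehner.inv {N m : ℕ} {M : SL(2, ℝ)} (h : IsAtkinLehner N m M) :
    IsAtkinLehner N m M⁻¹ := by
  obtain ⟨h1, h2, a, b, c, d, hM⟩ := h
  refine ⟨h1, h2, d, -b, -c, a, ?_⟩
  rw [Matrix.SpecialLinearGroup.coe_inv, hM, Matrix.adjugate_fin_two]
  ext i j
  fin_cases i <;> fin_cases j <;> simp

theorem IsAtkinLehner.conj_mem {N m : ℕ} [NeZero N] {M : SL(2, ℝ)} (h : IsAtkinLehner N m M)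
    {g : SL(2, ℝ)} (hg : g ∈ Gamma0R N) : M * g * M⁻¹ ∈ Gamma0R N := by
  obtain ⟨⟨n, hn⟩, -, a, b, c, d, hM⟩ := h
  obtain ⟨α, β, γ, δ, hg⟩ := mem_Gamma0R_iff.mp hg
  have hm : 0 < m := Nat.pos_of_ne_zero (by rintro rfl; exact NeZero.ne N (by simpa using hn))
  have hmR : (m : ℝ) ≠ 0 := by exact_mod_cast hm.ne'
  have hs0 : Real.sqrt (m : ℝ) ≠ 0 := (Real.sqrt_pos.mpr (by exact_mod_cast hm)).ne'
  have hs : Real.sqrt (m : ℝ) ^ 2 = m := Real.sq_sqrt (by positivity)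
  have hN : (N : ℝ) = m * n := by exact_mod_cast hn
  refine mem_Gamma0R_iff.mpr
    ⟨(m * a * α + b * N * γ) * d - (m * a * β + b * δ) * n * c,
      -((a * α + b * n * γ) * b) + (m * a * β + b * δ) * a,
      (c * α + m * d * γ) * d - (n * c * β + d * δ) * c,
      -((n * c * α + d * N * γ) * b) + (N * c * β + m * d * δ) * a, ?_⟩
  rw [Matrix.SpecialLinearGroup.coe_mul, Matrix.SpecialLinearGroup.coe_mul,
    Matrix.SpecialLinearGroup.coe_inv, hM, hg, Matrix.adjugate_fin_two]
  ext i j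
  fin_cases i <;> fin_cases j <;> simp [hN] <;> field_simp <;> rw [hs] <;> ring

theorem IsAtkinLehner.mem_Norm {N m : ℕ} [NeZero N] {M : SL(2, ℝ)} (h : IsAtkinLehner N m M) :
    M ∈ Norm N :=
  mem_Norm_of (fun _ hg => h.conj_mem hg) (fun g hg => by simpa using h.inv.conj_mem hg)

theorem dvd_sub_of_dvd_24 {h : ℕ} (h24 : h ∣ 24) {a d : ℤ} (had : (h : ℤ) ∣ a * d - 1) :
    (h : ℤ) ∣ a - d := by
  have key : ∀ k ∈ Nat.divisors 24, ∀ x y : ZMod k, x * y = 1 → x = y := by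
    intro k hk
    have hk' : k ∈ ({1, 2, 3, 4, 6, 8, 12, 24} : Finset ℕ) := by
      have hd : Nat.divisors 24 = {1, 2, 3, 4, 6, 8, 12, 24} := by decide +kernel
      rwa [hd] at hk
    fin_cases hk' <;> decide +kernel
  have h1 : ((a : ZMod h)) * (d : ZMod h) = 1 := by
    have := (ZMod.intCast_zmod_eq_zero_iff_dvd _ _).mpr had
    push_cast at this
    exact sub_eq_zero.mp this
  have h2 := key h (by simpa using h24) _ _ h1
  exact (ZMod.intCast_zmod_eq_zero_iff_dvd _ _).mp (by push_cast; exact sub_eq_zero.mpr h2)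

theorem shift_mem_Norm {N h : ℕ} [NeZero N] (h24 : h ∣ 24) (hN : h ^ 2 ∣ N) :
    shift h ∈ Norm N := by
  obtain ⟨n, hn⟩ := hN
  have hh : (h : ℝ) ≠ 0 := by
    have : h ≠ 0 := by rintro rfl; simp at h24
    exact_mod_cast this
  have hNR : (N : ℝ) = h ^ 2 * n := by exact_mod_cast hn
  have aux : ∀ g ∈ Gamma0R N, ∃ a b c d k : ℤ, a - d = h * k ∧
      (g : Matrix (Fin 2) (Fin 2) ℝ) = !![(a : ℝ), (b : ℝ); (N : ℝ) * c, (d : ℝ)] := by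
    intro g hg
    obtain ⟨a, b, c, d, hg⟩ := mem_Gamma0R_iff.mp hg
    have hdet : a * d - b * (N * c) = 1 := by
      have h1 : (g : Matrix (Fin 2) (Fin 2) ℝ).det = 1 := g.2
      rw [hg, Matrix.det_fin_two_of] at h1
      exact_mod_cast h1
    have had : (h : ℤ) ∣ a * d - 1 := ⟨b * (h * n * c), by
      rw [hn] at hdet; push_cast at hdet; linear_combination hdet⟩
    obtain ⟨k, hk⟩ := dvd_sub_of_dvd_24 h24 had
    exact ⟨a, b, c, d, k, hk, hg⟩
  refine mem_Norm_of (fun g hg => ?_) (fun g hg => ?_)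
  · obtain ⟨a, b, c, d, k, hk, hg⟩ := aux g hg
    have hkR : (a : ℝ) = d + h * k := by
      have : (a : ℝ) - d = h * k := by exact_mod_cast hk
      linarith
    refine mem_Gamma0R_iff.mpr ⟨a + h * n * c, b - k - n * c, c, d - h * n * c, ?_⟩
    rw [Matrix.SpecialLinearGroup.coe_mul, Matrix.SpecialLinearGroup.coe_mul,
      Matrix.SpecialLinearGroup.coe_inv, hg, Matrix.adjugate_fin_two]
    ext i j
    fin_cases i <;> fin_cases j <;> simp [shift, hNR, hkR] <;> field_simp <;> ring
  · obtain ⟨a, b, c, d, k, hk, hg⟩ := aux g hg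
    have hkR : (a : ℝ) = d + h * k := by
      have : (a : ℝ) - d = h * k := by exact_mod_cast hk
      linarith
    refine mem_Gamma0R_iff.mpr ⟨a - h * n * c, b + k - n * c, c, d + h * n * c, ?_⟩
    rw [Matrix.SpecialLinearGroup.coe_mul, Matrix.SpecialLinearGroup.coe_mul,
      Matrix.SpecialLinearGroup.coe_inv, hg, Matrix.adjugate_fin_two]
    ext i j
    fin_cases i <;> fin_cases j <;> simp [shift, hNR, hkR] <;> field_simp <;> ring

theorem width_dvd (N p : ℕ) : width N p ∣ 24 := by
  unfold width
  split_ifs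
  · exact (pow_dvd_pow 2 (min_le_left 3 _)).trans (by norm_num)
  · exact (pow_dvd_pow 3 (min_le_left 1 _)).trans (by norm_num)
  · exact one_dvd _

theorem width_sq_dvd (N p : ℕ) : width N p ^ 2 ∣ N := by
  unfold width
  split_ifs
  · rw [← pow_mul]
    exact (pow_dvd_pow 2 (by omega)).trans (Nat.ordProj_dvd N 2)
  · rw [← pow_mul]
    exact (pow_dvd_pow 3 (by omega)).trans (Nat.ordProj_dvd N 3)
  · simp

/-- The class in `Norm(Γ₀(N)) / Γ₀(N)` of an Atkin–Lehner matrix. -/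
def atkinLehnerClass {N m : ℕ} [NeZero N] {M : SL(2, ℝ)} (h : IsAtkinLehner N m M) : NormQuot N :=
  QuotientGroup.mk ⟨M, h.mem_Norm⟩

/-- The class in `Norm(Γ₀(N)) / Γ₀(N)` of the translation `S_h`, where `h` is the `p`-part
of `v(N)`. -/
noncomputable def shiftClass (N : ℕ) [NeZero N] (p : ℕ) : NormQuot N :=
  QuotientGroup.mk ⟨shift (width N p), shift_mem_Norm (width_dvd N p) (width_sq_dvd N p)⟩

/-- `G` is the (internal, not necessarily direct) product of the finitely many subgroups `H i`:
they permute pairwise, `H i * H j = H j * H i`, and for every ordering `l` of the index set each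
element of `G` is in exactly one way a product, in that order, of elements of the `H i`. -/
def IsInternalProduct {ι G : Type*} [Group G] (H : ι → Subgroup G) : Prop :=
  (∀ i j, (H i : Set G) * (H j : Set G) = (H j : Set G) * (H i : Set G)) ∧
  ∀ l : List ι, l.Nodup → (∀ i, i ∈ l) →
    Function.Bijective fun x : (i : ι) → H i => (l.map fun i => (x i : G)).prod

/-- `R` is a set of defining relators, in letters `0` and `1`, of the subgroup generated
by `x` and `y`. -/
def HasDefiningRelators {G : Type*} [Group G] (x y : G) (R : Set (FreeGroup (Fin 2))) : Prop :=
  (FreeGroup.lift ![x, y]).ker = Subgroup.normalClosure R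

/-- The letter standing for the Atkin–Lehner generator. -/
def letterW : FreeGroup (Fin 2) := FreeGroup.of 0

/-- The letter standing for the translation generator. -/
def letterS : FreeGroup (Fin 2) := FreeGroup.of 1

end Gamma0Normalizer

/-!
Every matrix `M` of the normalizer is, up to a real scalar, an integral matrix `A`, and at each
prime `p` one can ask whether `A` may be chosen invertible at `p` and upper triangular modulo the
`p`-part of `N`. This condition defines a subgroup `localGamma0 N p` of `SL₂(ℝ)` containing
`Γ₀(N)`, and an element satisfying it at all primes lies in `Γ₀(N)`
(`mem_Gamma0R_of_forall_mem_localGamma0`). The generators `w_q`, `S_q` at a prime `q ≠ p` satisfy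
the condition at `p`. The heart of the product decomposition is `exists_mul_mem_localGamma0`: each
`M` in the normalizer can be multiplied by an element of the group generated by `w_p` and `S_p` so
as to satisfy the condition at `p`. Indeed, for `D = det A`, conjugating elements of `Γ₀(N)` by `M`
gives divisibilities such as `D ∣ a²`, `D N ∣ c²`, `D N ∣ c d (x² - 1)` for all `x` prime to `N`,
and some `x² - 1` has the same `p`-part as `24`; these leave few possibilities for the valuations
of the entries of `A`. Hence the image of `localGamma0 N p` in the quotient is a
complement of the factor at `p` and contains the other factors, and the intersection of these
complements is trivial, so the quotient is the internal product of the factors, in any order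
(`isInternalProduct_of_complements`).

The structure of a factor comes from normal forms. Whenever `w sⁱ w sʲ` can be rewritten with at
most one power of `s` between two letters `w` (`HasRewriting`), each element of the group generated
by the involution `w` and by `s` has the form `sⁱ w sʲ` or `sⁱ w sʲ w`. In the quotient, the former
are never trivial and the latter only if the width `h` of the prime divides `i` and `j`, as the
entries of the matrices show. So relators are defining once they imply the rewriting rule, and
orders are found by counting normal forms. The rule has three sources: `(w sʲ)³ = 1` for `j` prime
to `p` (when the `p`-part of `N` is `h²`), the commutation of `s` with `w s w` (when it is
divisible by `h³`), and the relator of length twelve for `2⁸`. The relations themselves are checked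
on matrices, with the Cayley–Hamilton theorem for the powers `(w s)³` and `(w s)⁴`.
-/

namespace Gamma0Normalizer

/-! ### Internal products from complements -/

section InternalProduct

variable {ι G : Type*} [Group G] {H T : ι → Subgroup G}

theorem list_prod_mem_of_ne (hHT : ∀ i j, i ≠ j → H i ≤ T j) (x : (i : ι) → H i) {a : ι}
    {l : List ι} (ha : a ∉ l) : (l.map fun i => (x i : G)).prod ∈ T a := by
  refine Subgroup.list_prod_mem _ fun g hg => ?_
  obtain ⟨i, hi, rfl⟩ := List.mem_map.mp hg
  exact hHT i a (fun h => ha (by rw [← h]; exact hi)) (x i).2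

/-- The factors are split off from the left, one complement `T a` at a time. -/
theorem exists_list_prod_eq (hHT : ∀ i j, i ≠ j → H i ≤ T j)
    (hT : ∀ g, (∀ i, g ∈ T i) → g = 1) (hcov : ∀ i g, ∃ f ∈ H i, f * g ∈ T i) :
    ∀ l : List ι, l.Nodup → ∀ g, (∀ j, j ∉ l → g ∈ T j) →
      ∃ x : (i : ι) → H i, (l.map fun i => (x i : G)).prod = g := by
  classical
  intro l
  induction l with
  | nil => exact fun _ g hg => ⟨fun _ => 1, by simpa using (hT g fun i => hg i (by simp)).symm⟩
  | cons a l ih =>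
    intro hl g hg
    obtain ⟨hal, hl'⟩ := List.nodup_cons.mp hl
    obtain ⟨f, hf, hfg⟩ := hcov a g
    obtain ⟨x, hx⟩ := ih hl' (f * g) fun j hj => by
      by_cases hja : j = a
      · exact hja ▸ hfg
      · exact mul_mem (hHT a j (Ne.symm hja) hf) (hg j (by simp [hja, hj]))
    refine ⟨Function.update x a ⟨f⁻¹, inv_mem hf⟩, ?_⟩
    have : (l.map fun i => ((Function.update x a ⟨f⁻¹, inv_mem hf⟩ : (i : ι) → H i) i : G)) =
        l.map fun i => (x i : G) := by
      refine List.map_congr_left fun i hi => ?_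
      rw [Function.update_of_ne (fun h => hal (by rw [← h]; exact hi))]
    rw [List.map_cons, List.prod_cons, this, hx]
    simp

/-- Two first factors in `H a` differ by an element of `T a`, since the remaining factors lie in
`T a`; being in `H a`, it also lies in every other `T j`. -/
theorem list_prod_injective (hHT : ∀ i j, i ≠ j → H i ≤ T j)
    (hT : ∀ g, (∀ i, g ∈ T i) → g = 1) (x y : (i : ι) → H i) :
    ∀ l : List ι, l.Nodup →
      (l.map fun i => (x i : G)).prod = (l.map fun i => (y i : G)).prod → ∀ i ∈ l, x i = y i := by
  intro l
  induction l with
  | nil => simp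
  | cons a l ih =>
    intro hl h
    obtain ⟨hal, hl'⟩ := List.nodup_cons.mp hl
    rw [List.map_cons, List.prod_cons, List.map_cons, List.prod_cons] at h
    have hP := list_prod_mem_of_ne hHT x hal
    have hQ := list_prod_mem_of_ne hHT y hal
    have key : (y a : G)⁻¹ * x a = 1 := by
      refine hT _ fun j => ?_
      by_cases hja : j = a
      · subst hja
        have : (y j : G)⁻¹ * x j = (l.map fun i => (y i : G)).prod *
            ((l.map fun i => (x i : G)).prod)⁻¹ := by
          rw [eq_mul_inv_iff_mul_eq, mul_assoc, h, inv_mul_cancel_left]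
        exact this ▸ mul_mem hQ (inv_mem hP)
      · exact hHT a j (Ne.symm hja) (mul_mem (inv_mem (y a).2) (x a).2)
    have hxy : (x a : G) = y a := (inv_mul_eq_one.mp key).symm
    rw [hxy, mul_right_inj] at h
    intro i hi
    rcases List.mem_cons.mp hi with rfl | hi
    · exact Subtype.ext hxy
    · exact ih hl' h i hi

/-- A group is the internal product of subgroups `H i` as soon as there are subgroups `T i`
with trivial intersection such that `T i` complements `H i` (that is, `H i * T i` is everything)
and contains every other `H j`. -/
theorem isInternalProduct_of_complements (hHT : ∀ i j, i ≠ j → H i ≤ T j)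
    (hT : ∀ g, (∀ i, g ∈ T i) → g = 1) (hcov : ∀ i g, ∃ f ∈ H i, f * g ∈ T i) :
    IsInternalProduct H := by
  have hsub : ∀ i j, (H i : Set G) * (H j : Set G) ⊆ (H j : Set G) * (H i : Set G) := by
    rintro i j _ ⟨x, hx, y, hy, rfl⟩
    by_cases hij : i = j
    · subst hij; exact ⟨x, hx, y, hy, rfl⟩
    obtain ⟨f, hf, hfT⟩ := hcov j (x * y)
    obtain ⟨f', hf', hfT'⟩ := hcov i (f * (x * y))
    have h1 : f' * (f * (x * y)) = 1 := by
      refine hT _ fun k => ?_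
      by_cases hki : k = i
      · exact hki ▸ hfT'
      refine mul_mem (hHT i k (Ne.symm hki) hf') ?_
      by_cases hkj : k = j
      · exact hkj ▸ hfT
      exact mul_mem (hHT j k (Ne.symm hkj) hf)
        (mul_mem (hHT i k (Ne.symm hki) hx) (hHT j k (Ne.symm hkj) hy))
    refine ⟨f⁻¹, inv_mem hf, f'⁻¹, inv_mem hf', ?_⟩
    change f⁻¹ * f'⁻¹ = x * y
    rw [← mul_inv_rev, inv_eq_iff_mul_eq_one, mul_assoc, h1]
  refine ⟨fun i j => (hsub i j).antisymm (hsub j i), fun l hl hall => ⟨fun x y hxy => ?_, ?_⟩⟩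
  · exact funext fun i => list_prod_injective hHT hT x y l hl hxy i (hall i)
  · exact fun g => exists_list_prod_eq hHT hT hcov l hl g fun j hj => absurd (hall j) hj

end InternalProduct

/-! ### Normal forms in groups generated by an involution and another element -/

/-- Every product `w sⁱ w sʲ` can be rewritten with at most one further power of `s` between
two letters `w`. -/
def HasRewriting {P : Type*} [Group P] (w s : P) : Prop :=
  ∀ i j : ℤ, ∃ i' j' : ℤ,
    w * s ^ i * w * s ^ j = s ^ i' * w * s ^ j' ∨ w * s ^ i * w * s ^ j = s ^ i' * w * s ^ j' * w

section NormalForm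

variable {P : Type*} [Group P] {w s : P}

theorem conj_zpow_of_mul_self (hw : w * w = 1) (i : ℤ) : w * s ^ i * w = (w * s * w) ^ i := by
  have hi : w⁻¹ = w := inv_eq_of_mul_eq_one_left hw
  have := (conj_zpow (a := w) (b := s) (i := i)).symm
  rwa [hi] at this

theorem zpow_eq_zpow_of_emod {h : ℕ} (hs : s ^ h = 1) {i j : ℤ} (hij : i ≡ j [ZMOD h]) :
    s ^ i = s ^ j := by
  rw [← orderOf_dvd_iff_pow_eq_one] at hs
  rw [zpow_eq_zpow_iff_modEq]
  exact hij.of_dvd (by exact_mod_cast hs)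

theorem zpow_eq_one_of_dvd {h : ℕ} (hs : s ^ h = 1) {i : ℤ} (hi : (h : ℤ) ∣ i) : s ^ i = 1 := by
  obtain ⟨k, rfl⟩ := hi
  rw [zpow_mul, zpow_natCast, hs, one_zpow]

/-- The rewriting rule makes the set of elements `sⁱ w sʲ`, `sⁱ w sʲ w` stable under left
multiplication by the generators. -/
theorem exists_normalForm (hw : w * w = 1) (hr : HasRewriting w s) {g : P}
    (hg : g ∈ Subgroup.closure {w, s}) :
    ∃ i j : ℤ, g = s ^ i * w * s ^ j ∨ g = s ^ i * w * s ^ j * w := by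
  have hwi : w⁻¹ = w := inv_eq_of_mul_eq_one_left hw
  have hS : ∀ (k : ℤ) (y : P), (∃ i j : ℤ, y = s ^ i * w * s ^ j ∨ y = s ^ i * w * s ^ j * w) →
      ∃ i j : ℤ, s ^ k * y = s ^ i * w * s ^ j ∨ s ^ k * y = s ^ i * w * s ^ j * w := by
    rintro k y ⟨i, j, rfl | rfl⟩
    · exact ⟨k + i, j, Or.inl (by simp only [zpow_add, mul_assoc])⟩
    · exact ⟨k + i, j, Or.inr (by simp only [zpow_add, mul_assoc])⟩
  have hW : ∀ y : P, (∃ i j : ℤ, y = s ^ i * w * s ^ j ∨ y = s ^ i * w * s ^ j * w) →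
      ∃ i j : ℤ, w * y = s ^ i * w * s ^ j ∨ w * y = s ^ i * w * s ^ j * w := by
    rintro y ⟨i, j, rfl | rfl⟩
    · simpa only [mul_assoc] using hr i j
    · obtain ⟨i', j', h | h⟩ := hr i j
      · exact ⟨i', j', Or.inr (by rw [← h]; simp only [mul_assoc])⟩
      · refine ⟨i', j', Or.inl ?_⟩
        rw [show w * (s ^ i * w * s ^ j * w) = w * s ^ i * w * s ^ j * w by
          simp only [mul_assoc], h, mul_assoc _ w w, hw, mul_one]
  induction hg using Subgroup.closure_induction_left with
  | one => exact ⟨0, 0, Or.inr (by simp [hw])⟩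
  | mul_left x hx y _ ih =>
    rcases hx with rfl | rfl
    · exact hW y ih
    · simpa using hS 1 y ih
  | inv_mul_cancel x hx y _ ih =>
    rcases hx with rfl | rfl
    · rw [hwi]; exact hW y ih
    · simpa using hS (-1) y ih

theorem HasRewriting.of_commute (hw : w * w = 1) (hc : Commute (w * s * w) s) :
    HasRewriting w s := by
  intro i j
  refine ⟨j, i, Or.inr ?_⟩
  have h := (hc.zpow_zpow i j).eq
  rw [conj_zpow_of_mul_self hw, h, ← conj_zpow_of_mul_self hw]
  simp only [mul_assoc]

/-- Put `t = w s w`. The relator and its conjugate by `w` give `s³ t = t⁻³ s⁻¹` and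
`s³ t³ = t⁻¹ s⁻¹`. Hence `t²` commutes with `s`, and `t s = s⁻³ t⁻³` moves odd powers. -/
theorem HasRewriting.of_order_eight (hw : w * w = 1)
    (hr : w * s * w * s * w * s ^ 3 * w * s ^ 3 = 1) : HasRewriting w s := by
  have hwi : w⁻¹ = w := inv_eq_of_mul_eq_one_left hw
  obtain ⟨t, ht⟩ : ∃ t, t = w * s * w := ⟨_, rfl⟩
  have hpow : ∀ i : ℤ, w * s ^ i * w = t ^ i := fun i => ht ▸ conj_zpow_of_mul_self hw i
  have hcs : MulAut.conj w s = t := by rw [MulAut.conj_apply, hwi, ht]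
  have hct : MulAut.conj w t = s := by
    rw [MulAut.conj_apply, hwi, ht, show w * (w * s * w) * w = (w * w) * s * (w * w) by
      simp only [mul_assoc], hw]
    simp
  have h1 : t * s * t ^ 3 * s ^ 3 = 1 := by
    have e3 : w * s ^ 3 * w = t ^ 3 := by exact_mod_cast hpow 3
    rw [← hr, ← e3, ht]; simp only [mul_assoc]
  have h2 : s * t * s ^ 3 * t ^ 3 = 1 := by
    have := congrArg (MulAut.conj w) h1
    simpa only [map_mul, map_pow, hcs, hct, map_one] using this
  have h3 : t * s = (s ^ 3)⁻¹ * (t ^ 3)⁻¹ := by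
    rw [← mul_inv_rev, eq_inv_iff_mul_eq_one, ← mul_assoc]; exact h1
  have hcomm : Commute (t ^ 2) s := by
    have h4 : s ^ 3 * t = (t ^ 3)⁻¹ * s⁻¹ := by
      have := mul_eq_one_iff_inv_eq.mp h1
      rw [← this]; group
    have h5 : s ^ 3 * t ^ 3 = t⁻¹ * s⁻¹ := by
      rw [← mul_inv_rev, eq_inv_iff_mul_eq_one]
      have := mul_eq_one_iff_eq_inv.mp ((mul_assoc (s * t) (s ^ 3) (t ^ 3)).symm.trans h2)
      rw [this, mul_inv_cancel]
    have h6 : s ^ 3 * t ^ 3 = (t ^ 3)⁻¹ * s⁻¹ * t ^ 2 := by rw [← h4]; group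
    have h7 : s⁻¹ * t ^ 2 = t ^ 2 * s⁻¹ := by
      rw [h5] at h6
      have := congrArg (t ^ 3 * ·) h6
      simp only [mul_assoc, mul_inv_cancel_left] at this
      rw [← this]; group
    exact (Commute.inv_left_iff.mp h7).symm
  have hcomm' : Commute (s ^ 2) t := by
    have := hcomm.map (MulAut.conj w)
    rwa [map_pow, hct, hcs] at this
  have ht2 : ∀ a : ℤ, Commute (t ^ (2 * a)) s := fun a => by
    rw [zpow_mul]; exact_mod_cast hcomm.zpow_left a
  have hs2 : ∀ a : ℤ, Commute (s ^ (2 * a)) t := fun a => by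
    rw [zpow_mul]; exact_mod_cast hcomm'.zpow_left a
  have hz : ∀ i j : ℤ, t ^ i * s ^ j = s ^ j * t ^ i ∨
      t ^ i * s ^ j = s ^ (j - 4) * t ^ (i - 4) := by
    intro i j
    obtain ⟨a, rfl | rfl⟩ := Int.even_or_odd' i
    · left
      exact ((ht2 a).zpow_right j).eq
    obtain ⟨b, rfl | rfl⟩ := Int.even_or_odd' j
    · left
      exact ((hs2 b).zpow_right _).eq.symm
    · right
      have e1 : Commute (t ^ (2 * a)) ((s ^ 3)⁻¹) := ((ht2 a).pow_right 3).inv_right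
      have e2 : Commute (s ^ (2 * b)) ((t ^ 3)⁻¹) := ((hs2 b).pow_right 3).inv_right
      have e3 : Commute (t ^ (2 * a)) (s ^ (2 * b)) := (ht2 a).zpow_right _
      calc t ^ (2 * a + 1) * s ^ (2 * b + 1)
          = t ^ (2 * a) * (t * s) * s ^ (2 * b) := by
            rw [zpow_add_one, add_comm (2 * b), zpow_add, zpow_one]; simp only [mul_assoc]
        _ = (s ^ 3)⁻¹ * t ^ (2 * a) * s ^ (2 * b) * (t ^ 3)⁻¹ := by
            rw [h3, ← e1.eq, mul_assoc _ (s ^ (2 * b)), e2.eq]; simp only [mul_assoc]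
        _ = ((s ^ 3)⁻¹ * s ^ (2 * b)) * (t ^ (2 * a) * (t ^ 3)⁻¹) := by
            rw [mul_assoc _ (t ^ (2 * a)), e3.eq]; simp only [mul_assoc]
        _ = s ^ (2 * b + 1 - 4) * t ^ (2 * a + 1 - 4) := by group
  intro i j
  rw [hpow]
  rcases hz i j with h | h
  · exact ⟨j, i, Or.inr (by rw [h, ← hpow]; simp only [mul_assoc])⟩
  · exact ⟨j - 4, i - 4, Or.inr (by rw [h, ← hpow]; simp only [mul_assoc])⟩

theorem mul_zpow_mul_of_cube {j : ℤ} (hw : w * w = 1) (h : (w * s ^ j) ^ 3 = 1) :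
    w * s ^ j * w = s ^ (-j) * w * s ^ (-j) := by
  have hwi : w⁻¹ = w := inv_eq_of_mul_eq_one_left hw
  have e : w * s ^ j * w * (s ^ j * w * s ^ j) = 1 := by
    rw [← h]; simp only [pow_succ, pow_zero, one_mul, mul_assoc]
  rw [mul_eq_one_iff_eq_inv.mp e]
  simp only [mul_inv_rev, hwi, zpow_neg, mul_assoc]

/-- The rewriting rule of `PSL₂`, given that `w sʲ w = s⁻ʲ w s⁻ʲ` for `j` prime to `p`. When `i` is
divisible by `p`, a power of `s` to the right of `w sⁱ w` can be moved to its left, at the cost of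
changing the exponents, with the inner exponent still divisible by `p`. -/
theorem HasRewriting.of_cube {p : ℤ} (hp : ¬ p ∣ 1) (hw : w * w = 1)
    (h : ∀ j : ℤ, ¬ p ∣ j → w * s ^ j * w = s ^ (-j) * w * s ^ (-j)) :
    HasRewriting w s ∧
      ∀ i j : ℤ, p ∣ i → ∃ i' j' : ℤ, p ∣ j' ∧ w * s ^ i * w * s ^ j = s ^ i' * w * s ^ j' * w := by
  have hww : ∀ x, w * (w * x) = x := fun x => by rw [← mul_assoc, hw, one_mul]
  -- A single letter `s ^ ε` is moved to the left across `w s ^ i w`.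
  have hstep : ∀ ε : ℤ, ¬ p ∣ ε → ∀ i : ℤ, p ∣ i →
      w * s ^ i * w * s ^ ε = s ^ (ε - i) * w * s ^ (-i) * w := by
    intro ε hε i hi
    have e1 := h (i - ε) (fun hd => hε (by simpa using (dvd_sub hi hd)))
    have e2 := h ε hε
    calc w * s ^ i * w * s ^ ε = w * s ^ (i - ε) * w * (w * s ^ ε * w) * s ^ ε := by
          simp only [mul_assoc, hww]
          rw [← mul_assoc (s ^ (i - ε)), ← zpow_add, sub_add_cancel]
      _ = s ^ (ε - i) * w * s ^ (-i) * w := by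
          rw [e1, e2]
          simp only [mul_assoc]
          rw [← zpow_add, neg_add_cancel, zpow_zero, mul_one,
            ← mul_assoc (s ^ (-(i - ε))) (s ^ (-ε)), ← zpow_add, neg_sub,
            sub_add_eq_add_sub, sub_eq_neg_add]
          simp
  have hB : ∀ j i : ℤ, p ∣ i → ∃ i' j' : ℤ, p ∣ j' ∧
      w * s ^ i * w * s ^ j = s ^ i' * w * s ^ j' * w := by
    intro j
    have hadd : ∀ ε : ℤ, ¬ p ∣ ε → ∀ j : ℤ, (∀ i : ℤ, p ∣ i → ∃ i' j' : ℤ, p ∣ j' ∧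
        w * s ^ i * w * s ^ j = s ^ i' * w * s ^ j' * w) → ∀ i : ℤ, p ∣ i → ∃ i' j' : ℤ, p ∣ j' ∧
        w * s ^ i * w * s ^ (j + ε) = s ^ i' * w * s ^ j' * w := by
      intro ε hε j ih i hi
      obtain ⟨i', j', hj', e⟩ := ih i hi
      refine ⟨i' + (ε - j'), -j', hj'.neg_right, ?_⟩
      calc w * s ^ i * w * s ^ (j + ε) = w * s ^ i * w * s ^ j * s ^ ε := by
            rw [zpow_add, ← mul_assoc]
        _ = s ^ i' * (w * s ^ j' * w * s ^ ε) := by rw [e]; simp only [mul_assoc]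
        _ = s ^ (i' + (ε - j')) * w * s ^ (-j') * w := by
            rw [hstep ε hε j' hj', zpow_add]; simp only [mul_assoc]
    induction j with
    | zero => exact fun i hi => ⟨0, i, hi, by simp⟩
    | succ k ih => exact hadd 1 hp k ih
    | pred k ih =>
      simpa only [sub_eq_add_neg] using hadd (-1) (by rwa [dvd_neg]) (-k) ih
  refine ⟨fun i j => ?_, fun i j => hB j i⟩
  by_cases hi : p ∣ i
  · obtain ⟨i', j', -, e⟩ := hB j i hi
    exact ⟨i', j', Or.inr e⟩
  · exact ⟨-i, -i + j, Or.inl (by rw [h i hi, zpow_add]; simp only [mul_assoc])⟩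

theorem zpow_mul_mul_zpow_inj {h : ℕ} (hw : w * w = 1)
    (h1 : ∀ i j : ℤ, s ^ i * w * s ^ j * w = 1 → (h : ℤ) ∣ i ∧ (h : ℤ) ∣ j) {a b a' b' : ℤ}
    (e : s ^ a * w * s ^ b = s ^ a' * w * s ^ b') : (h : ℤ) ∣ a - a' ∧ (h : ℤ) ∣ b - b' := by
  refine h1 _ _ ?_
  calc s ^ (a - a') * w * s ^ (b - b') * w = s ^ (-a') * (s ^ a * w * s ^ b) * s ^ (-b') * w := by
        rw [sub_eq_neg_add, sub_eq_add_neg, zpow_add, zpow_add]; simp only [mul_assoc]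
    _ = w * w := by rw [e]; group
    _ = 1 := hw

theorem fin_eq_of_dvd_sub {n : ℕ} {x y : Fin n} (h : (n : ℤ) ∣ (x : ℤ) - (y : ℤ)) : x = y := by
  have hx := x.2
  have hy := y.2
  have := Int.eq_zero_of_abs_lt_dvd h (by rw [abs_lt]; constructor <;> omega)
  exact Fin.ext (by omega)

theorem exists_fin_modEq {n : ℕ} (hn : 0 < n) (j : ℤ) : ∃ x : Fin n, j ≡ (x : ℤ) [ZMOD n] := by
  have h0 : (0 : ℤ) ≤ j % n := Int.emod_nonneg _ (by omega)
  have h1 : j % n < n := Int.emod_lt_of_pos _ (by omega)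
  refine ⟨⟨(j % n).toNat, by omega⟩, ?_⟩
  simp only [Int.toNat_of_nonneg h0]
  exact (Int.mod_modEq _ _).symm

/-- The order of a group generated by an involution `w` and an element `s` of order `h = p k`,
counted by normal forms: there are `h²` elements `sⁱ w sʲ`, and every other element is one of
the `h k` elements `sⁱ w s^(p j) w`. -/
theorem card_closure_of_normalForm {h p k : ℕ} (hh : 0 < h) (hpk : h = p * k) (hw : w * w = 1)
    (hs : s ^ h = 1) (hr : HasRewriting w s)
    (hred : ∀ j : ℤ, ¬ (p : ℤ) ∣ j → ∃ i' j' : ℤ, w * s ^ j * w = s ^ i' * w * s ^ j')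
    (h1 : ∀ i j : ℤ, s ^ i * w * s ^ j * w = 1 → (h : ℤ) ∣ i ∧ (h : ℤ) ∣ j)
    (h3 : ∀ a b c : ℤ, (p : ℤ) ∣ c → s ^ a * w * s ^ b * w * s ^ c * w ≠ 1) :
    Nat.card (Subgroup.closure {w, s}) = h * h + h * k := by
  have hk : 0 < k := Nat.pos_of_ne_zero (by rintro rfl; omega)
  have hp : 0 < p := Nat.pos_of_ne_zero (by rintro rfl; omega)
  have hwm : w ∈ Subgroup.closure {w, s} := Subgroup.subset_closure (by simp)
  have hsm : s ∈ Subgroup.closure {w, s} := Subgroup.subset_closure (by simp)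
  let f : (Fin h × Fin h) ⊕ (Fin h × Fin k) → P :=
    Sum.elim (fun x => s ^ (x.1 : ℤ) * w * s ^ (x.2 : ℤ))
      (fun x => s ^ (x.1 : ℤ) * w * s ^ ((p : ℤ) * (x.2 : ℤ)) * w)
  have hne : ∀ a b a' c : ℤ, (p : ℤ) ∣ c → s ^ a * w * s ^ b ≠ s ^ a' * w * s ^ c * w := by
    intro a b a' c hc e
    refine h3 (a - a') b (-c) hc.neg_right ?_
    calc s ^ (a - a') * w * s ^ b * w * s ^ (-c) * w
        = s ^ (-a') * (s ^ a * w * s ^ b) * w * s ^ (-c) * w := by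
          rw [sub_eq_neg_add, zpow_add]; simp only [mul_assoc]
      _ = w * s ^ c * (w * w) * s ^ (-c) * w := by rw [e]; group
      _ = w * w := by simp [hw]
      _ = 1 := hw
  have hf : Function.Injective f := by
    rintro (⟨a, b⟩ | ⟨a, b⟩) (⟨a', b'⟩ | ⟨a', b'⟩) e
    · obtain ⟨ha, hb⟩ := zpow_mul_mul_zpow_inj hw h1 e
      exact congrArg Sum.inl (Prod.ext (fin_eq_of_dvd_sub ha) (fin_eq_of_dvd_sub hb))
    · exact absurd e (hne _ _ _ _ (dvd_mul_right _ _))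
    · exact absurd e.symm (hne _ _ _ _ (dvd_mul_right _ _))
    · obtain ⟨ha, hb⟩ := zpow_mul_mul_zpow_inj hw h1 (mul_right_cancel e)
      have hb' : (p : ℤ) * k ∣ p * ((b : ℤ) - b') := by
        rw [mul_sub]; convert hb; exact_mod_cast hpk.symm
      exact congrArg Sum.inr (Prod.ext (fin_eq_of_dvd_sub ha)
        (fin_eq_of_dvd_sub (Int.dvd_of_mul_dvd_mul_left (by exact_mod_cast hp.ne') hb')))
  have hrange : Set.range f = (Subgroup.closure {w, s} : Set P) := by
    refine Set.Subset.antisymm ?_ ?_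
    · rintro _ ⟨⟨a, b⟩ | ⟨a, b⟩, rfl⟩
      · exact mul_mem (mul_mem (zpow_mem hsm _) hwm) (zpow_mem hsm _)
      · exact mul_mem (mul_mem (mul_mem (zpow_mem hsm _) hwm) (zpow_mem hsm _)) hwm
    · have hA : ∀ i j : ℤ, s ^ i * w * s ^ j ∈ Set.range f := by
        intro i j
        obtain ⟨a, ha⟩ := exists_fin_modEq hh i
        obtain ⟨b, hb⟩ := exists_fin_modEq hh j
        refine ⟨Sum.inl (a, b), ?_⟩
        change s ^ (a : ℤ) * w * s ^ (b : ℤ) = _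
        rw [zpow_eq_zpow_of_emod hs ha, zpow_eq_zpow_of_emod hs hb]
      intro g hg
      obtain ⟨i, j, rfl | rfl⟩ := exists_normalForm hw hr hg
      · exact hA i j
      · by_cases hj : (p : ℤ) ∣ j
        · obtain ⟨j, rfl⟩ := hj
          obtain ⟨a, ha⟩ := exists_fin_modEq hh i
          obtain ⟨b, hb⟩ := exists_fin_modEq hk j
          refine ⟨Sum.inr (a, b), ?_⟩
          change s ^ (a : ℤ) * w * s ^ ((p : ℤ) * (b : ℤ)) * w = _
          have hb' : (p : ℤ) * j ≡ p * (b : ℤ) [ZMOD h] := by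
            rw [hpk, Nat.cast_mul]; exact hb.mul_left'
          rw [zpow_eq_zpow_of_emod hs ha, zpow_eq_zpow_of_emod hs hb']
        · obtain ⟨i', j', e⟩ := hred j hj
          have := hA (i + i') j'
          rwa [zpow_add, mul_assoc, mul_assoc, ← mul_assoc (s ^ i'), ← e, ← mul_assoc,
            ← mul_assoc] at this
  rw [← SetLike.coe_sort_coe, ← hrange, ← Nat.card_congr (Equiv.ofInjective f hf)]
  simp

/-- The order `h² + h k` of a group satisfying the rewriting rule of `PSL₂`, where `h = p k`. -/
theorem card_closure_of_cube {h p k : ℕ} (hh : 0 < h) (hpk : h = p * k) (hp : ¬ (p : ℤ) ∣ 1)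
    (hw : w * w = 1) (hs : s ^ h = 1)
    (hc : ∀ j : ℤ, ¬ (p : ℤ) ∣ j → w * s ^ j * w = s ^ (-j) * w * s ^ (-j))
    (h1 : ∀ i j : ℤ, s ^ i * w * s ^ j * w = 1 → (h : ℤ) ∣ i ∧ (h : ℤ) ∣ j)
    (h2 : ∀ i j : ℤ, s ^ i * w * s ^ j ≠ 1) :
    Nat.card (Subgroup.closure {w, s}) = h * h + h * k := by
  obtain ⟨hr, hB⟩ := HasRewriting.of_cube hp hw hc
  refine card_closure_of_normalForm hh hpk hw hs hr (fun j hj => ⟨_, _, hc j hj⟩) h1 ?_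
  intro a b c hcp e
  by_cases hb : (p : ℤ) ∣ b
  · obtain ⟨i', j', -, e'⟩ := hB b c hb
    refine h2 (a + i') j' ?_
    rw [← e, zpow_add, show s ^ a * w * s ^ b * w * s ^ c * w =
      s ^ a * (w * s ^ b * w * s ^ c) * w by simp only [mul_assoc], e']
    simp only [mul_assoc, hw, mul_one]
  · have := (h1 (a - b) (c - b) ?_).2
    · have hd : (p : ℤ) ∣ c - b := (by rw [hpk]; simp : (p : ℤ) ∣ h).trans this
      exact hb (by simpa using dvd_sub hcp hd)
    · rw [← e, show s ^ a * w * s ^ b * w * s ^ c * w = s ^ a * (w * s ^ b * w) * s ^ c * w by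
        simp only [mul_assoc], hc b hb, sub_eq_add_neg, sub_eq_neg_add, zpow_add, zpow_add]
      simp only [mul_assoc]

/-- The order `2 h²` of a group generated by an involution `w` and an element `s` of order `h`
that commutes with its conjugate `w s w`. -/
theorem card_closure_of_commute {h : ℕ} (hh : 0 < h) (hw : w * w = 1) (hs : s ^ h = 1)
    (hc : Commute (w * s * w) s)
    (h1 : ∀ i j : ℤ, s ^ i * w * s ^ j * w = 1 → (h : ℤ) ∣ i ∧ (h : ℤ) ∣ j)
    (h2 : ∀ i j : ℤ, s ^ i * w * s ^ j ≠ 1) :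
    Nat.card (Subgroup.closure {w, s}) = h * h + h * h := by
  refine card_closure_of_normalForm (p := 1) hh (one_mul h).symm hw hs (.of_commute hw hc)
    (fun j hj => absurd (one_dvd _) hj) h1 fun a b c _ e => h2 (a + c) b ?_
  have h := (hc.zpow_zpow b c).eq
  rw [← conj_zpow_of_mul_self hw] at h
  rw [← e, show s ^ a * w * s ^ b * w * s ^ c * w = s ^ a * (w * s ^ b * w * s ^ c) * w by
    simp only [mul_assoc], h, zpow_add]
  simp only [mul_assoc, hw, mul_one]

/-- Relators are defining as soon as they force the rewriting rule and the normal forms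
`sⁱ w sʲ w`, `sⁱ w sʲ` are trivial only when forced to be. -/
theorem hasDefiningRelators_of_normalForm {h : ℕ} {R : Set (FreeGroup (Fin 2))}
    (hR : ∀ r ∈ R, FreeGroup.lift ![w, s] r = 1)
    (hrel : ∀ {Q : Type} [Group Q] (x y : Q), (∀ r ∈ R, FreeGroup.lift ![x, y] r = 1) →
      x * x = 1 ∧ y ^ h = 1 ∧ HasRewriting x y)
    (h1 : ∀ i j : ℤ, s ^ i * w * s ^ j * w = 1 → (h : ℤ) ∣ i ∧ (h : ℤ) ∣ j)
    (h2 : ∀ i j : ℤ, s ^ i * w * s ^ j ≠ 1) : HasDefiningRelators w s R := by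
  refine le_antisymm (fun g hg => ?_) (Subgroup.normalClosure_le_normal fun r hr => hR r hr)
  let π : FreeGroup (Fin 2) →* FreeGroup (Fin 2) ⧸ Subgroup.normalClosure R := QuotientGroup.mk' _
  have hπ : FreeGroup.lift ![π letterW, π letterS] = π := by
    ext i; fin_cases i <;> simp [letterW, letterS]
  obtain ⟨hx, hy, hr⟩ := hrel (π letterW) (π letterS) fun r hr => by
    rw [hπ]; exact (QuotientGroup.eq_one_iff r).mpr (Subgroup.subset_normalClosure hr)
  have hmem : π g ∈ Subgroup.closure {π letterW, π letterS} := by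
    have : g ∈ Subgroup.closure (Set.range (FreeGroup.of : Fin 2 → FreeGroup (Fin 2))) := by
      rw [FreeGroup.closure_range_of]; trivial
    have h := Subgroup.mem_map_of_mem π this
    rw [MonoidHom.map_closure] at h
    refine Subgroup.closure_mono ?_ h
    rintro _ ⟨_, ⟨i, rfl⟩, rfl⟩
    fin_cases i
    · exact Or.inl rfl
    · exact Or.inr rfl
  have hlift : ∀ g', π g' = π g → FreeGroup.lift ![w, s] g' = 1 := by
    intro g' h
    have hle : Subgroup.normalClosure R ≤ (FreeGroup.lift ![w, s]).ker :=
      Subgroup.normalClosure_le_normal fun r hr => hR r hr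
    have := hle (QuotientGroup.eq.mp h)
    rw [MonoidHom.mem_ker, map_mul, map_inv, MonoidHom.mem_ker.mp hg, mul_one, inv_eq_one] at this
    exact this
  refine (QuotientGroup.eq_one_iff g).mp ?_
  change π g = 1
  obtain ⟨i, j, e | e⟩ := exists_normalForm hx hr hmem
  · have := hlift (letterS ^ i * letterW * letterS ^ j) (by rw [e]; simp)
    exact absurd (by simpa [letterW, letterS] using this) (h2 i j)
  · have := hlift (letterS ^ i * letterW * letterS ^ j * letterW) (by rw [e]; simp)
    obtain ⟨hi, hj⟩ := h1 i j (by simpa [letterW, letterS] using this)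
    rw [e, zpow_eq_one_of_dvd hy hi, zpow_eq_one_of_dvd hy hj, one_mul, mul_one, hx]

end NormalForm

/-! ### Real matrices with integral multiples -/

/-- `r M` is the integral matrix `[a, b; c, d]`. -/
def Scales (M : SL(2, ℝ)) (r : ℝ) (a b c d : ℤ) : Prop :=
  r • (M : Matrix (Fin 2) (Fin 2) ℝ) = !![(a : ℝ), (b : ℝ); (c : ℝ), (d : ℝ)]

section Scales

variable {M M' : SL(2, ℝ)} {r r' : ℝ} {a b c d a' b' c' d' : ℤ}

theorem scales_iff : Scales M r a b c d ↔
    r * M 0 0 = a ∧ r * M 0 1 = b ∧ r * M 1 0 = c ∧ r * M 1 1 = d := by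
  unfold Scales
  rw [← Matrix.ext_iff]
  simp [Fin.forall_fin_two, and_assoc]

theorem det_entries (M : SL(2, ℝ)) : M 0 0 * M 1 1 - M 0 1 * M 1 0 = 1 := by
  have := M.2
  rwa [Matrix.det_fin_two] at this

theorem Scales.sq (h : Scales M r a b c d) : r ^ 2 = ((a * d - b * c : ℤ) : ℝ) := by
  obtain ⟨h1, h2, h3, h4⟩ := scales_iff.mp h
  push_cast
  rw [← h1, ← h2, ← h3, ← h4]
  linear_combination (-r ^ 2) * det_entries M

theorem Scales.mul (h : Scales M r a b c d) (h' : Scales M' r' a' b' c' d') :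
    Scales (M * M') (r * r') (a * a' + b * c') (a * b' + b * d') (c * a' + d * c')
      (c * b' + d * d') := by
  unfold Scales at *
  rw [Matrix.SpecialLinearGroup.coe_mul, ← smul_mul_smul_comm, h, h', Matrix.mul_fin_two]
  push_cast
  rfl

theorem Scales.inv (h : Scales M r a b c d) : Scales M⁻¹ r d (-b) (-c) a := by
  obtain ⟨h1, h2, h3, h4⟩ := scales_iff.mp h
  rw [scales_iff, Matrix.SpecialLinearGroup.coe_inv, Matrix.adjugate_fin_two]
  push_cast
  simp [← h1, ← h2, ← h3, ← h4]

theorem Scales.div {k : ℤ} (hk : k ≠ 0) (h : Scales M r (k * a) (k * b) (k * c) (k * d)) :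
    Scales M (r / k) a b c d := by
  obtain ⟨h1, h2, h3, h4⟩ := scales_iff.mp h
  have hk' : (k : ℝ) ≠ 0 := by exact_mod_cast hk
  push_cast at h1 h2 h3 h4
  rw [scales_iff]
  refine ⟨?_, ?_, ?_, ?_⟩ <;> field_simp <;> assumption

theorem Scales.smul (h : Scales M r a b c d) (k : ℤ) :
    Scales M (k * r) (k * a) (k * b) (k * c) (k * d) := by
  obtain ⟨h1, h2, h3, h4⟩ := scales_iff.mp h
  rw [scales_iff]
  push_cast
  rw [← h1, ← h2, ← h3, ← h4]
  simp only [mul_assoc, and_self]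

theorem Scales.congr {a₁ b₁ c₁ d₁ : ℤ} (h : Scales M r a b c d) (ha : a = a₁) (hb : b = b₁)
    (hc : c = c₁) (hd : d = d₁) : Scales M r a₁ b₁ c₁ d₁ := by
  subst ha hb hc hd; exact h

theorem mem_Gamma0R_iff_scales {N : ℕ} :
    M ∈ Gamma0R N ↔ ∃ a b c d : ℤ, Scales M 1 a b (N * c) d := by
  rw [mem_Gamma0R_iff]
  unfold Scales
  push_cast
  simp only [one_smul]

/-- An element of `Γ₀(N)` from an integral multiple. -/
theorem Scales.mem_Gamma0R {N : ℕ} {k : ℤ} (hk : k ≠ 0)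
    (h : Scales M k (k * a) (k * b) (k * (N * c)) (k * d)) : M ∈ Gamma0R N := by
  have := h.div hk
  rw [div_self (by exact_mod_cast hk)] at this
  exact mem_Gamma0R_iff_scales.mpr ⟨_, _, _, _, this⟩

theorem Scales.of_mem_Gamma0R {N : ℕ} (hM : M ∈ Gamma0R N) (h : Scales M r a b c d) :
    ∃ a' b' c' d' : ℤ, r * a' = a ∧ r * b' = b ∧ r * (N * c') = c ∧ r * d' = d := by
  obtain ⟨a', b', c', d', h'⟩ := mem_Gamma0R_iff_scales.mp hM
  obtain ⟨h1, h2, h3, h4⟩ := scales_iff.mp h'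
  rw [one_mul] at h1 h2 h3 h4
  push_cast at h3
  obtain ⟨e1, e2, e3, e4⟩ := scales_iff.mp h
  exact ⟨a', b', c', d', by rw [← h1, e1], by rw [← h2, e2], by rw [← h3, e3], by rw [← h4, e4]⟩

theorem coe_shift_zpow (h : ℕ) (i : ℤ) :
    ((shift h ^ i : SL(2, ℝ)) : Matrix (Fin 2) (Fin 2) ℝ) = !![1, i / (h : ℝ); 0, 1] := by
  have hinv : (((shift h)⁻¹ : SL(2, ℝ)) : Matrix (Fin 2) (Fin 2) ℝ) =
      !![1, -(1 / (h : ℝ)); 0, 1] := by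
    rw [Matrix.SpecialLinearGroup.coe_inv, shift, Matrix.adjugate_fin_two_of, neg_zero]
  induction i with
  | zero => simp [Matrix.one_fin_two]
  | succ n ih =>
    rw [zpow_add_one, Matrix.SpecialLinearGroup.coe_mul, ih, shift, Matrix.mul_fin_two]
    push_cast
    simp [add_div, add_comm]
  | pred n ih =>
    rw [zpow_sub_one, Matrix.SpecialLinearGroup.coe_mul, ih, hinv,
      Matrix.mul_fin_two]
    push_cast
    simp [sub_div, neg_div]
    ring

theorem scales_shift_zpow {h : ℕ} (hh : h ≠ 0) (i : ℤ) : Scales (shift h ^ i) h h i 0 h := by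
  have hh' : (h : ℝ) ≠ 0 := by exact_mod_cast hh
  unfold Scales
  rw [coe_shift_zpow]
  ext i j
  fin_cases i <;> fin_cases j <;> simp
  field_simp

theorem IsAtkinLehner.exists_scales {N m : ℕ} [NeZero N] (h : IsAtkinLehner N m M) :
    ∃ n : ℕ, ∃ a b c d : ℤ, N = m * n ∧ m ≠ 0 ∧ n ≠ 0 ∧ m.Coprime n ∧
      (m : ℤ) * a * d - n * b * c = 1 ∧ Scales M (Real.sqrt m) (m * a) b (N * c) (m * d) := by
  obtain ⟨⟨n, hn⟩, hcop, a, b, c, d, hM⟩ := h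
  have hN := NeZero.ne N
  have hm : m ≠ 0 := by rintro rfl; simp at hn; exact hN hn
  have hn0 : n ≠ 0 := by rintro rfl; simp at hn; exact hN hn
  rw [hn, Nat.mul_div_cancel_left n (Nat.pos_of_ne_zero hm)] at hcop
  have hs0 : Real.sqrt (m : ℝ) ≠ 0 :=
    (Real.sqrt_pos.mpr (by exact_mod_cast Nat.pos_of_ne_zero hm)).ne'
  have hS : Scales M (Real.sqrt m) (m * a) b (N * c) (m * d) := by
    unfold Scales
    rw [hM, smul_smul, mul_one_div, div_self hs0, one_smul]
    push_cast; rfl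
  refine ⟨n, a, b, c, d, hn, hm, hn0, hcop, ?_, hS⟩
  have := hS.sq
  rw [Real.sq_sqrt (by positivity)] at this
  have e : (m : ℤ) = m * a * (m * d) - b * (N * c) := by exact_mod_cast this
  rw [hn] at e
  push_cast at e
  have hm' : (m : ℤ) ≠ 0 := by exact_mod_cast hm
  apply mul_left_cancel₀ hm'
  linear_combination -e

/-- A matrix with an integral multiple has a multiple with coprime integral entries. -/
theorem Scales.exists_primitive (h : Scales M r a b c d) (hr : r ≠ 0) :
    ∃ r' : ℝ, ∃ a' b' c' d' x y z t : ℤ, r' ≠ 0 ∧ Scales M r' a' b' c' d' ∧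
      x * a' + y * b' + z * c' + t * d' = 1 := by
  have key : ∀ a b : ℤ, ∃ g a' b' x y : ℤ, a = g * a' ∧ b = g * b' ∧ x * a + y * b = g := by
    intro a b
    obtain ⟨a', ha⟩ := Int.gcd_dvd_left a b
    obtain ⟨b', hb⟩ := Int.gcd_dvd_right a b
    exact ⟨Int.gcd a b, a', b', Int.gcdA a b, Int.gcdB a b, ha, hb, by
      rw [Int.gcd_eq_gcd_ab]; ring⟩
  obtain ⟨g₁, a₁, b₁, x₁, y₁, rfl, rfl, h₁⟩ := key a b
  obtain ⟨g₂, c₁, d₁, z₁, t₁, rfl, rfl, h₂⟩ := key c d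
  obtain ⟨g, u, v, x, y, rfl, rfl, h₃⟩ := key g₁ g₂
  have hg : g ≠ 0 := by
    rintro rfl
    have := h.sq
    simp at this
    exact hr this
  simp only [mul_assoc] at h
  refine ⟨r / g, _, _, _, _, x * x₁, x * y₁, y * z₁, y * t₁, ?_, h.div hg, ?_⟩
  · exact div_ne_zero hr (by exact_mod_cast hg)
  · apply mul_left_cancel₀ hg
    linear_combination x * h₁ + y * h₂ + h₃

end Scales

/-! ### The local condition at a prime -/

/-- The elements of `SL₂(ℝ)` that up to a real scalar are integral matrices, invertible at `p`
and upper triangular modulo the `p`-part of `N`. -/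
def localGamma0 (N p : ℕ) : Subgroup SL(2, ℝ) where
  carrier := {M | ∃ r : ℝ, ∃ a b c d : ℤ, Scales M r a b c d ∧
    (p : ℤ) ^ N.factorization p ∣ c ∧ IsCoprime (p : ℤ) (a * d - b * c)}
  one_mem' := ⟨1, 1, 0, 0, 1, by simp [scales_iff], by simp, by simp [isCoprime_one_right]⟩
  mul_mem' := by
    rintro M M' ⟨r, a, b, c, d, h, hc, hp⟩ ⟨r', a', b', c', d', h', hc', hp'⟩
    refine ⟨_, _, _, _, _, h.mul h', dvd_add (hc.mul_right _) (hc'.mul_left _), ?_⟩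
    have := hp.mul_right hp'
    convert this using 1
    ring
  inv_mem' := by
    rintro M ⟨r, a, b, c, d, h, hc, hp⟩
    refine ⟨_, _, _, _, _, h.inv, hc.neg_right, ?_⟩
    convert hp using 1
    ring

theorem mem_localGamma0 {N p : ℕ} {M : SL(2, ℝ)} : M ∈ localGamma0 N p ↔
    ∃ r : ℝ, ∃ a b c d : ℤ, Scales M r a b c d ∧
      (p : ℤ) ^ N.factorization p ∣ c ∧ IsCoprime (p : ℤ) (a * d - b * c) := Iff.rfl

theorem factorization_pow_dvd_cast (N p : ℕ) : (p : ℤ) ^ N.factorization p ∣ (N : ℤ) := by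
  exact_mod_cast Nat.ordProj_dvd N p

theorem Gamma0R_le_localGamma0 (N p : ℕ) : Gamma0R N ≤ localGamma0 N p := by
  intro M hM
  obtain ⟨a, b, c, d, h⟩ := mem_Gamma0R_iff_scales.mp hM
  refine ⟨1, a, b, N * c, d, h, (factorization_pow_dvd_cast N p).mul_right c, ?_⟩
  have := h.sq
  rw [one_pow] at this
  rw [← show (1 : ℤ) = a * d - b * (N * c) by exact_mod_cast this]
  exact isCoprime_one_right

theorem shift_mem_localGamma0 {N p h : ℕ} (hh : h ≠ 0) (hp : p.Coprime h) :
    shift h ∈ localGamma0 N p := by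
  have := scales_shift_zpow hh 1
  rw [zpow_one] at this
  refine ⟨_, _, _, _, _, this, dvd_zero _, ?_⟩
  rw [mul_zero, sub_zero]
  exact (Nat.isCoprime_iff_coprime.mpr hp).mul_right (Nat.isCoprime_iff_coprime.mpr hp)

theorem IsAtkinLehner.mem_localGamma0 {N m p : ℕ} [NeZero N] {M : SL(2, ℝ)}
    (h : IsAtkinLehner N m M) (hp : p.Coprime m) : M ∈ localGamma0 N p := by
  obtain ⟨n, a, b, c, d, hN, -, -, -, hdet, hS⟩ := h.exists_scales
  refine ⟨_, _, _, _, _, hS, (factorization_pow_dvd_cast N p).mul_right c, ?_⟩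
  have : (m : ℤ) * a * (m * d) - b * (N * c) = m := by
    rw [hN]; push_cast; linear_combination (m : ℤ) * hdet
  rw [this]
  exact Nat.isCoprime_iff_coprime.mpr hp

/-- An element of `SL₂(ℝ)` satisfying the local conditions at all primes lies in `Γ₀(N)`:
its primitive integral multiple has a determinant prime to every prime. -/
theorem mem_Gamma0R_of_forall_mem_localGamma0 {N : ℕ} [NeZero N] {M : SL(2, ℝ)}
    (h : ∀ p : ℕ, p.Prime → M ∈ localGamma0 N p) : M ∈ Gamma0R N := by
  obtain ⟨r₂, a₂, b₂, c₂, d₂, h₂, -, hp₂⟩ := h 2 Nat.prime_two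
  have hr₂ : r₂ ≠ 0 := by
    rintro rfl
    have := h₂.sq
    rw [zero_pow two_ne_zero] at this
    rw [show a₂ * d₂ - b₂ * c₂ = 0 by exact_mod_cast this.symm] at hp₂
    rw [isCoprime_zero_right] at hp₂
    exact absurd hp₂ (by decide)
  obtain ⟨r, a, b, c, d, x, y, z, t, hr, hS, hbez⟩ := h₂.exists_primitive hr₂
  have hloc : ∀ p : ℕ, p.Prime →
      (p : ℤ) ^ N.factorization p ∣ c ∧ IsCoprime (p : ℤ) (a * d - b * c) := by
    intro p hp
    obtain ⟨r', a', b', c', d', hS', hc', hdet'⟩ := h p hp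
    obtain ⟨e1, e2, e3, e4⟩ := scales_iff.mp hS
    obtain ⟨f1, f2, f3, f4⟩ := scales_iff.mp hS'
    obtain ⟨k, hk⟩ : ∃ k : ℤ, k = x * a' + y * b' + z * c' + t * d' := ⟨_, rfl⟩
    have hbezR : (x * a + y * b + z * c + t * d : ℝ) = 1 := by exact_mod_cast hbez
    have hkR : (k : ℝ) = x * a' + y * b' + z * c' + t * d' := by rw [hk]; push_cast; ring
    have hrk : r' = r * k := by
      rw [← e1, ← e2, ← e3, ← e4] at hbezR
      rw [hkR, ← f1, ← f2, ← f3, ← f4]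
      linear_combination (-r') * hbezR
    have g : ∀ u v : ℤ, ∀ q : ℝ, r * q = u → r' * q = v → v = k * u := by
      intro u v q hu hv
      have : (v : ℝ) = k * u := by rw [← hu, ← hv, hrk]; ring
      exact_mod_cast this
    rw [g _ _ _ e1 f1, g _ _ _ e2 f2, g _ _ _ e3 f3, g _ _ _ e4 f4,
      show k * a * (k * d) - k * b * (k * c) = k * (k * (a * d - b * c)) by ring] at hdet'
    rw [g _ _ _ e3 f3] at hc'
    have hpk : IsCoprime (p : ℤ) k := hdet'.of_mul_right_left
    exact ⟨hpk.pow_left.dvd_of_dvd_mul_left hc', hdet'.of_mul_right_right.of_mul_right_right⟩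
  have hdet : a * d - b * c = 1 := by
    have hpos : 0 < a * d - b * c := by
      have : (0 : ℝ) < ((a * d - b * c : ℤ) : ℝ) := by rw [← hS.sq]; positivity
      exact_mod_cast this
    by_contra hne
    obtain ⟨p, hp, hpd⟩ := Nat.exists_prime_and_dvd (n := (a * d - b * c).natAbs) (by omega)
    exact (Nat.prime_iff_prime_int.mp hp).not_isUnit
      ((hloc p hp).2.isUnit_of_dvd' dvd_rfl (Int.natCast_dvd.mpr hpd))
  have hNc : (N : ℤ) ∣ c := by
    rw [Int.natCast_dvd, Nat.dvd_iff_prime_pow_dvd_dvd]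
    intro p k hp hk
    have := (hp.pow_dvd_iff_le_factorization (NeZero.ne N)).mp hk
    rw [← Int.natCast_dvd]
    push_cast
    exact (pow_dvd_pow _ this).trans (hloc p hp).1
  obtain ⟨c, rfl⟩ := hNc
  have hr1 : r = 1 ∨ r = -1 := by
    have := hS.sq
    rw [hdet, Int.cast_one] at this
    simpa using this
  rcases hr1 with rfl | rfl
  · exact mem_Gamma0R_iff_scales.mpr ⟨_, _, _, _, hS⟩
  · refine Scales.mem_Gamma0R (k := -1) (a := -a) (b := -b) (c := -c) (d := -d) (by norm_num) ?_
    simpa using hS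

/-! ### Integrality conditions on elements of the normalizer -/

section Normalizer

variable {N : ℕ} {M : SL(2, ℝ)} {r : ℝ} {a b c d : ℤ}

theorem exists_mem_Gamma0R {α β γ δ : ℤ} (h : α * δ - β * (N * γ) = 1) :
    ∃ g ∈ Gamma0R N, Scales g 1 α β (N * γ) δ := by
  refine ⟨⟨!![(α : ℝ), β; N * γ, δ], ?_⟩, ?_⟩
  · rw [Matrix.det_fin_two_of]; exact_mod_cast h
  · have : Scales ⟨!![(α : ℝ), β; N * γ, δ], by
        rw [Matrix.det_fin_two_of]; exact_mod_cast h⟩ 1 α β (N * γ) δ := by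
      unfold Scales; rw [one_smul]; push_cast; rfl
    exact ⟨mem_Gamma0R_iff_scales.mpr ⟨_, _, _, _, this⟩, this⟩

/-- Conjugating `U = [1, 1; 0, 1]` and `[1, 0; N, 1]` by an element `[A, B; C, D]` of the
normalizer, and `U` by its inverse, shows that `A²`, `AC`, `CD`, `C²`, `N B D`, `N D²` are
integers; hence `C³ M` is integral when `C ≠ 0`, and `N D M` when `C = 0`. -/
theorem exists_scales_of_mem_Norm [NeZero N] (hM : M ∈ Norm N) :
    ∃ r : ℝ, ∃ a b c d : ℤ, r ≠ 0 ∧ Scales M r a b c d := by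
  have hconj := Subgroup.mem_normalizer_iff.mp hM
  have hconj' := Subgroup.mem_normalizer_iff.mp (inv_mem hM)
  obtain ⟨A, B, C, D, hABCD⟩ : ∃ A B C D : ℝ,
      (M : Matrix (Fin 2) (Fin 2) ℝ) = !![A, B; C, D] := ⟨_, _, _, _, Matrix.eta_fin_two _⟩
  have hdet : A * D - B * C = 1 := by
    have := M.2
    rwa [hABCD, Matrix.det_fin_two_of] at this
  have hinv : ((M⁻¹ : SL(2, ℝ)) : Matrix (Fin 2) (Fin 2) ℝ) = !![D, -B; -C, A] := by
    rw [Matrix.SpecialLinearGroup.coe_inv, hABCD, Matrix.adjugate_fin_two_of]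
  have hcoe : ∀ {g : SL(2, ℝ)} {α β γ δ : ℤ}, Scales g 1 α β γ δ →
      (g : Matrix (Fin 2) (Fin 2) ℝ) = !![(α : ℝ), β; γ, δ] := fun h => by
    unfold Scales at h; rwa [one_smul] at h
  obtain ⟨U, hU, hU'⟩ := exists_mem_Gamma0R (N := N) (α := 1) (β := 1) (γ := 0) (δ := 1) (by ring)
  obtain ⟨V, hV, hV'⟩ := exists_mem_Gamma0R (N := N) (α := 1) (β := 0) (γ := 1) (δ := 1) (by ring)
  obtain ⟨a₁, b₁, c₁, d₁, h₁⟩ := mem_Gamma0R_iff.mp ((hconj U).mp hU)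
  obtain ⟨a₂, b₂, c₂, d₂, h₂⟩ := mem_Gamma0R_iff.mp ((hconj' U).mp hU)
  obtain ⟨a₃, b₃, c₃, d₃, h₃⟩ := mem_Gamma0R_iff.mp ((hconj V).mp hV)
  rw [inv_inv] at h₂
  rw [Matrix.SpecialLinearGroup.coe_mul, Matrix.SpecialLinearGroup.coe_mul, hinv, hABCD,
    hcoe hU', Matrix.mul_fin_two, Matrix.mul_fin_two] at h₁ h₂
  rw [Matrix.SpecialLinearGroup.coe_mul, Matrix.SpecialLinearGroup.coe_mul, hinv, hABCD,
    hcoe hV', Matrix.mul_fin_two, Matrix.mul_fin_two] at h₃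
  simp at h₁ h₂ h₃
  by_cases hC : C = 0
  · subst hC
    have hN : (N : ℝ) ≠ 0 := by exact_mod_cast NeZero.ne N
    have hD : D ≠ 0 := by rintro rfl; simp at hdet
    refine ⟨N * D, N, 1 - d₃, 0, N * c₃, mul_ne_zero hN hD, ?_⟩
    rw [scales_iff, hABCD]
    simp
    refine ⟨?_, ?_, ?_⟩
    · linear_combination (N : ℝ) * hdet
    · linarith [h₃.2.2]
    · linarith [h₃.2.1]
  · refine ⟨C ^ 3, -(N * c₁) * (d₁ - 1), (d₁ - 1) * (a₂ - 1) + N * c₁, (N * c₁) ^ 2,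
      -(N * c₁) * (a₂ - 1), ?_, ?_⟩
    · positivity
    rw [scales_iff, hABCD]
    have hCC : (N * c₁ : ℝ) = -C ^ 2 := by linear_combination -h₁.2.1
    have hAC : (d₁ : ℝ) = 1 + A * C := by linear_combination -h₁.2.2 + hdet
    have hCD : (a₂ : ℝ) = 1 + C * D := by linear_combination -h₂.1.1 + hdet
    push_cast
    rw [hCC, hAC, hCD]
    simp
    refine ⟨by ring, ?_, by ring, by ring⟩
    linear_combination (-C ^ 2) * hdet

/-- If `r M` is integral with determinant `D`, then `r² M g M⁻¹` lies in `D Γ₀(N)`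
for `g` in `Γ₀(N)`. -/
theorem dvd_of_mem_Norm (hM : M ∈ Norm N) (h : Scales M r a b c d) {α β γ δ : ℤ}
    (hg : α * δ - β * (N * γ) = 1) :
    (a * d - b * c) ∣ (a * α + b * (N * γ)) * d + (a * β + b * δ) * -c ∧
    (a * d - b * c) ∣ (a * α + b * (N * γ)) * -b + (a * β + b * δ) * a ∧
    (a * d - b * c) * N ∣ (c * α + d * (N * γ)) * d + (c * β + d * δ) * -c := by
  obtain ⟨g, hgN, hgS⟩ := exists_mem_Gamma0R hg
  have hmem := (Subgroup.mem_normalizer_iff.mp hM g).mp hgN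
  obtain ⟨a', b', c', d', h1, h2, h3, -⟩ := Scales.of_mem_Gamma0R hmem ((h.mul hgS).mul h.inv)
  rw [mul_one, ← sq, h.sq] at h1 h2 h3
  exact ⟨⟨a', by exact_mod_cast h1.symm⟩, ⟨b', by exact_mod_cast h2.symm⟩,
    ⟨c', by rw [mul_assoc]; exact_mod_cast h3.symm⟩⟩

/-- The conditions from `U = [1, 1; 0, 1]` and from `[1, 0; N, 1]`. -/
theorem basic_dvd_of_mem_Norm (hM : M ∈ Norm N) (h : Scales M r a b c d) :
    (a * d - b * c) ∣ a * a ∧ (a * d - b * c) * N ∣ c * c ∧ (a * d - b * c) ∣ a * c ∧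
    (a * d - b * c) ∣ N * (b * b) ∧ (a * d - b * c) ∣ N * (b * d) := by
  obtain ⟨u1, u2, u3⟩ := dvd_of_mem_Norm hM h (α := 1) (β := 1) (γ := 0) (δ := 1) (by ring)
  obtain ⟨v1, v2, -⟩ := dvd_of_mem_Norm hM h (α := 1) (β := 0) (γ := 1) (δ := 1) (by ring)
  have hD := dvd_refl (a * d - b * c)
  exact ⟨u2.trans (dvd_of_eq (by ring)), u3.neg_right.trans (dvd_of_eq (by ring)),
    (dvd_sub hD u1).trans (dvd_of_eq (by ring)), v2.neg_right.trans (dvd_of_eq (by ring)),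
    (dvd_sub v1 hD).trans (dvd_of_eq (by ring))⟩

/-- The conditions from a general element `[x, *; N, y]` of `Γ₀(N)`, using `x y ≡ 1` mod `N`. -/
theorem dvd_mul_sq_sub_one_of_mem_Norm (hM : M ∈ Norm N) (h : Scales M r a b c d) {x : ℤ}
    (hx : IsCoprime x (N : ℤ)) :
    (a * d - b * c) * N ∣ c * d * (x ^ 2 - 1) ∧ (a * d - b * c) ∣ a * b * (x ^ 2 - 1) := by
  obtain ⟨y, z, hyz⟩ := hx
  obtain ⟨-, g2, g3⟩ := dvd_of_mem_Norm hM h (α := x) (β := -z) (γ := 1) (δ := y)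
    (by linear_combination hyz)
  obtain ⟨k1, k2, -, k4, -⟩ := basic_dvd_of_mem_Norm hM h
  obtain ⟨i1, -, i3, -, i5⟩ := basic_dvd_of_mem_Norm (inv_mem hM) h.inv
  have hD : d * a - -b * -c = a * d - b * c := by ring
  rw [hD] at i1 i3 i5
  constructor
  · have e1 : (a * d - b * c) * N ∣ N * (d * d) := by
      rw [mul_comm]; exact mul_dvd_mul_left _ i1
    have e2 : (a * d - b * c) * N ∣ N * (d * -c) := by
      rw [mul_comm]; exact mul_dvd_mul_left _ i3
    have := dvd_sub (dvd_sub (dvd_mul_of_dvd_right g3 x) (dvd_mul_of_dvd_right e1 x))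
      (dvd_add (dvd_mul_of_dvd_right k2 (x * z)) (dvd_mul_of_dvd_right e2 (-z)))
    exact this.trans (dvd_of_eq (by linear_combination (-c * d) * hyz))
  · have := dvd_add (dvd_add (dvd_mul_of_dvd_right g2 (-x)) (dvd_mul_of_dvd_right k4 (-x)))
      (dvd_add (dvd_mul_of_dvd_right k1 (-x * z)) (dvd_mul_of_dvd_right i5 z))
    exact this.trans (dvd_of_eq (by linear_combination (-a * b) * hyz))

end Normalizer

/-! ### Reduction of the normalizer at one prime -/

theorem factorization_twentyFour_two : Nat.factorization 24 2 = 3 := by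
  rw [show 24 = 2 ^ 3 * 3 by norm_num, Nat.factorization_mul (by norm_num) (by norm_num),
    Nat.prime_two.factorization_pow, Nat.prime_three.factorization]
  simp

theorem factorization_twentyFour_three : Nat.factorization 24 3 = 1 := by
  rw [show 24 = 2 ^ 3 * 3 by norm_num, Nat.factorization_mul (by norm_num) (by norm_num),
    Nat.prime_two.factorization_pow, Nat.prime_three.factorization]
  simp

theorem factorization_twentyFour_of_ne {p : ℕ} (hp : p.Prime) (h2 : p ≠ 2) (h3 : p ≠ 3) :
    Nat.factorization 24 p = 0 := by
  refine Nat.factorization_eq_zero_of_not_dvd fun h => ?_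
  rw [show 24 = 2 ^ 3 * 3 by norm_num, hp.dvd_mul] at h
  rcases h with h | h
  · exact h2 ((Nat.prime_dvd_prime_iff_eq hp Nat.prime_two).mp (hp.dvd_of_dvd_pow h))
  · exact h3 ((Nat.prime_dvd_prime_iff_eq hp Nat.prime_three).mp h)

theorem width_eq_pow {p : ℕ} (hp : p.Prime) (N : ℕ) :
    width N p = p ^ min (Nat.factorization 24 p) (N.factorization p / 2) := by
  unfold width
  split_ifs with h2 h3
  · rw [h2, factorization_twentyFour_two]
  · rw [h3, factorization_twentyFour_three]
  · rw [factorization_twentyFour_of_ne hp h2 h3, Nat.zero_min, pow_zero]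

/-- A square divisible by `pⁿ` is the square of a multiple of `p ^ ⌈n / 2⌉`. -/
theorem pow_half_dvd_of_dvd_mul_self {p : ℕ} (hp : p.Prime) {n : ℕ} {a : ℤ}
    (h : (p : ℤ) ^ n ∣ a * a) : (p : ℤ) ^ ((n + 1) / 2) ∣ a := by
  have hp' := Nat.prime_iff_prime_int.mp hp
  by_cases ha : a = 0
  · simp [ha]
  have hfin : FiniteMultiplicity (p : ℤ) a :=
    Int.finiteMultiplicity_iff.mpr ⟨by simpa using hp.ne_one, ha⟩
  have hfin2 : FiniteMultiplicity (p : ℤ) (a * a) :=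
    Int.finiteMultiplicity_iff.mpr ⟨by simpa using hp.ne_one, mul_ne_zero ha ha⟩
  rw [hfin2.pow_dvd_iff_le_multiplicity, multiplicity_mul hp' hfin2] at h
  rw [hfin.pow_dvd_iff_le_multiplicity]
  omega

theorem isCoprime_of_not_dvd {p : ℕ} (hp : p.Prime) {a : ℤ} (h : ¬ (p : ℤ) ∣ a) :
    IsCoprime (p : ℤ) a :=
  (Nat.prime_iff_prime_int.mp hp).coprime_iff_not_dvd.mpr h

theorem not_dvd_of_isCoprime {p : ℕ} (hp : p.Prime) {a : ℤ} (h : IsCoprime (p : ℤ) a) :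
    ¬ (p : ℤ) ∣ a :=
  (Nat.prime_iff_prime_int.mp hp).coprime_iff_not_dvd.mp h

theorem le_of_prime_pow_dvd {p : ℕ} (hp : p.Prime) {i j : ℕ} {u : ℤ} (hu : ¬ (p : ℤ) ∣ u)
    (h : (p : ℤ) ^ i ∣ (p : ℤ) ^ j * u) : i ≤ j := by
  have := ((isCoprime_of_not_dvd hp hu).pow_left (m := i)).dvd_of_dvd_mul_right h
  exact (Nat.pow_dvd_pow_iff_le_right hp.one_lt).mp (by exact_mod_cast this)

theorem pow_sub_dvd_of_dvd_mul_pow {p : ℕ} (hp : p.Prime) {n e : ℕ} {a : ℤ}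
    (h : (p : ℤ) ^ n ∣ a * (p : ℤ) ^ e) : (p : ℤ) ^ (n - e) ∣ a := by
  rcases le_total n e with hne | hne
  · simp [Nat.sub_eq_zero_of_le hne]
  · rw [← Nat.sub_add_cancel hne, pow_add] at h
    exact Int.dvd_of_mul_dvd_mul_right (pow_ne_zero _ (by exact_mod_cast hp.ne_zero)) h

/-- Some unit `x` modulo `N` has `x² - 1` exactly as divisible by `p` as the number `24`. -/
theorem exists_isCoprime_sq_sub_one {p N : ℕ} (hp : p.Prime) [NeZero N] :
    ∃ x u : ℤ, IsCoprime x (N : ℤ) ∧ x ^ 2 - 1 = (p : ℤ) ^ Nat.factorization 24 p * u ∧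
      ¬ (p : ℤ) ∣ u := by
  have hpi := Nat.prime_iff_prime_int.mp hp
  obtain ⟨x₀, u₀, hx₀, hu₀, h₀⟩ : ∃ x₀ u₀ : ℤ, ¬ (p : ℤ) ∣ x₀ ∧ ¬ (p : ℤ) ∣ u₀ ∧
      x₀ ^ 2 - 1 = (p : ℤ) ^ Nat.factorization 24 p * u₀ := by
    by_cases h2 : p = 2
    · subst h2
      exact ⟨5, 3, by decide, by decide, by rw [factorization_twentyFour_two]; norm_num⟩
    by_cases h3 : p = 3
    · subst h3
      exact ⟨2, 1, by decide, by decide, by rw [factorization_twentyFour_three]; norm_num⟩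
    have hdvd : ∀ q : ℕ, q.Prime → p ≠ q → ¬ (p : ℤ) ∣ q := fun q hq hne h =>
      hne ((Nat.prime_dvd_prime_iff_eq hp hq).mp (by exact_mod_cast h))
    exact ⟨2, 3, hdvd 2 Nat.prime_two h2, hdvd 3 Nat.prime_three h3, by
      rw [factorization_twentyFour_of_ne hp h2 h3]; norm_num⟩
  obtain ⟨N', hN'⟩ := Nat.ordProj_dvd N p
  have hpN' : IsCoprime ((p : ℤ) ^ (Nat.factorization 24 p + 1)) (N' : ℤ) := by
    have h := Nat.coprime_ordCompl hp (NeZero.ne N)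
    rw [Nat.div_eq_of_eq_mul_right (pow_pos hp.pos _) hN'] at h
    exact (Nat.isCoprime_iff_coprime.mpr h).pow_left
  -- The Chinese remainder theorem: `x ≡ x₀` modulo `p ^ (v_p(24) + 1)` and `x ≡ 1` modulo the
  -- prime-to-`p` part of `N`.
  obtain ⟨s, t, hst⟩ := hpN'
  rw [pow_succ] at hst
  refine ⟨x₀ + (1 - x₀) * (s * (p ^ Nat.factorization 24 p * p)),
    u₀ + p * (2 * x₀ * ((1 - x₀) * s) + (1 - x₀) ^ 2 * s ^ 2 * (p ^ Nat.factorization 24 p * p)),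
    ?_, ?_, ?_⟩
  · rw [hN']
    push_cast
    refine IsCoprime.mul_right (IsCoprime.pow_right ?_) ?_
    · refine (isCoprime_of_not_dvd hp fun h => hx₀ ?_).symm
      exact (dvd_add_left ⟨(1 - x₀) * (s * p ^ Nat.factorization 24 p), by ring⟩).mp h
    · exact ⟨1, (1 - x₀) * t, by linear_combination (1 - x₀) * hst⟩
  · linear_combination h₀
  · exact fun h => hu₀ ((dvd_add_left (dvd_mul_right _ _)).mp h)

theorem width_ne_zero (N p : ℕ) : width N p ≠ 0 := fun h0 => by
  have := width_dvd N p
  rw [h0] at this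
  simp at this

/-- The shape of an Atkin–Lehner matrix at a prime divisor of `N`, with the coprimality that
follows from its determinant. -/
theorem IsAtkinLehner.exists_scales_of_prime {N p : ℕ} [NeZero N] {W : SL(2, ℝ)} (hp : p.Prime)
    (hv : N.factorization p ≠ 0) (h : IsAtkinLehner N (p ^ N.factorization p) W) :
    ∃ n : ℕ, ∃ a b c d : ℤ, N = p ^ N.factorization p * n ∧ ¬ (p : ℤ) ∣ n ∧ ¬ (p : ℤ) ∣ c ∧
      ((p ^ N.factorization p : ℕ) : ℤ) * a * d - n * b * c = 1 ∧
      Scales W (Real.sqrt (p ^ N.factorization p : ℕ)) ((p ^ N.factorization p : ℕ) * a) b (N * c)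
        ((p ^ N.factorization p : ℕ) * d) := by
  obtain ⟨n, a, b, c, d, hN, hm0, -, hcop, hdet, hS⟩ := h.exists_scales
  refine ⟨n, a, b, c, d, hN, fun hd => ?_, fun hd => ?_, hdet, hS⟩
  · exact (Nat.Prime.coprime_iff_not_dvd hp).mp (hcop.coprime_dvd_left (dvd_pow_self p hv))
      (by exact_mod_cast hd)
  · refine (Nat.prime_iff_prime_int.mp hp).not_isUnit (isUnit_of_dvd_one ?_)
    rw [← hdet]
    refine dvd_sub (((?_ : (p : ℤ) ∣ _).mul_right _).mul_right _) (hd.mul_left _)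
    push_cast; exact dvd_pow_self _ hv

/-- The conjugate by an Atkin–Lehner matrix of a power of a translation. -/
theorem scales_conj_shift {N m n h k : ℕ} {W : SL(2, ℝ)} {α β γ δ : ℤ} (hN : N = m * n)
    (hm : m = h * k) (hm0 : m ≠ 0) (hdet : (m : ℤ) * α * δ - n * β * γ = 1)
    (hW : Scales W (Real.sqrt m) (m * α) β (N * γ) (m * δ)) (j : ℤ) :
    Scales (W * shift h ^ j * W⁻¹) 1 (1 - j * k * n * α * γ) (j * k * α ^ 2)
      (-(j * k * n ^ 2 * γ ^ 2)) (1 + j * k * n * α * γ) := by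
  have hh : h ≠ 0 := by rintro rfl; simp at hm; exact hm0 hm
  have hmh : ((m * h : ℕ) : ℤ) ≠ 0 := by exact_mod_cast mul_ne_zero hm0 hh
  have h1 := (hW.mul (scales_shift_zpow hh j)).mul hW.inv
  have h2 : Real.sqrt m * h * Real.sqrt m = ((m * h : ℕ) : ℤ) := by
    have : Real.sqrt (m : ℝ) * Real.sqrt m = m := Real.mul_self_sqrt (by positivity)
    push_cast
    linear_combination (h : ℝ) * this
  rw [h2] at h1
  have h3 := (h1.congr (a₁ := ((m * h : ℕ) : ℤ) * (1 - j * k * n * α * γ))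
    (b₁ := ((m * h : ℕ) : ℤ) * (j * k * α ^ 2))
    (c₁ := ((m * h : ℕ) : ℤ) * (-(j * k * n ^ 2 * γ ^ 2)))
    (d₁ := ((m * h : ℕ) : ℤ) * (1 + j * k * n * α * γ)) ?_ ?_ ?_ ?_).div hmh
  · rwa [div_self (by exact_mod_cast hmh)] at h3
  · rw [hN]; push_cast
    have hm' : (m : ℤ) = h * k := by exact_mod_cast hm
    linear_combination (m * h : ℤ) * hdet - (m * j * n * α * γ : ℤ) * hm'
  · push_cast
    have hm' : (m : ℤ) = h * k := by exact_mod_cast hm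
    linear_combination (m * j * α ^ 2 : ℤ) * hm'
  · rw [hN]; push_cast
    have hm' : (m : ℤ) = h * k := by exact_mod_cast hm
    linear_combination (-m * j * n ^ 2 * γ ^ 2 : ℤ) * hm'
  · rw [hN]; push_cast
    have hm' : (m : ℤ) = h * k := by exact_mod_cast hm
    linear_combination (m * h : ℤ) * hdet + (m * j * n * α * γ : ℤ) * hm'

theorem exists_dvd_add_mul {q t : ℤ} (ht : IsCoprime q t) (c : ℤ) : ∃ k : ℤ, q ∣ c + k * t := by
  obtain ⟨u, v, huv⟩ := ht
  exact ⟨-c * v, c * u, by linear_combination -c * huv⟩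

/-- An element of the normalizer with integral multiple `[h a, b; h² c, h d]`, `d` prime to `p`,
is turned by a translation into one with an integral multiple invertible at `p`. -/
theorem exists_shift_mul_scales {p h : ℕ} {M : SL(2, ℝ)} {r : ℝ} {a b c d : ℤ} (hh : h ≠ 0)
    (hS : Scales M r (h * a) b (h * h * c) (h * d)) (hdet : IsCoprime (p : ℤ) (a * d - b * c))
    (hd : IsCoprime (h : ℤ) d) :
    ∃ i : ℤ, ∃ r' : ℝ, ∃ a' b' c' d' : ℤ, Scales (shift h ^ i * M) r' a' b' c' d' ∧
      IsCoprime (p : ℤ) (a' * d' - b' * c') := by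
  obtain ⟨i, b', hb'⟩ := exists_dvd_add_mul hd b
  have hhh : (h * h : ℤ) ≠ 0 := by exact_mod_cast mul_ne_zero hh hh
  refine ⟨i, _, a + i * c, b', h * c, d,
    (((scales_shift_zpow hh i).mul hS).congr ?_ ?_ ?_ ?_).div hhh, ?_⟩
  · ring
  · linear_combination (h : ℤ) * hb'
  · ring
  · ring
  · convert hdet using 1
    linear_combination c * hb'

section Reduction

variable {N p : ℕ} [NeZero N] {W M : SL(2, ℝ)} {r : ℝ} {a b c d : ℤ}

theorem conj_shift_mem_closure (W s : SL(2, ℝ)) (k : ℤ) :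
    W * s ^ k * W⁻¹ ∈ Subgroup.closure {W, s} := by
  have hW : W ∈ Subgroup.closure {W, s} := Subgroup.subset_closure (by simp)
  have hs : s ∈ Subgroup.closure {W, s} := Subgroup.subset_closure (by simp)
  exact mul_mem (mul_mem hW (zpow_mem hs k)) (inv_mem hW)

/-- If `M` has an integral multiple invertible at `p`, its lower left entry is removed modulo the
`p`-part of `N` by a conjugate of a translation. -/
theorem exists_mul_mem_localGamma0_of_unit (hp : p.Prime)
    (hW : IsAtkinLehner N (p ^ N.factorization p) W) (hM : M ∈ Norm N)
    (h : Scales M r a b c d) (hpD : IsCoprime (p : ℤ) (a * d - b * c)) :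
    ∃ f ∈ Subgroup.closure {W, shift (width N p)}, f * M ∈ localGamma0 N p := by
  have hpi := Nat.prime_iff_prime_int.mp hp
  rw [width_eq_pow hp]
  rcases Nat.eq_zero_or_pos (N.factorization p) with hv0 | hv0
  · exact ⟨1, one_mem _, by
      rw [one_mul]; exact ⟨r, a, b, c, d, h, by rw [hv0, pow_zero]; exact one_dvd _, hpD⟩⟩
  obtain ⟨n, α, β, γ, δ, hN, hpn, hpγ, hdet, hWS⟩ := hW.exists_scales_of_prime hp hv0.ne'
  have hm0 : p ^ N.factorization p ≠ 0 := pow_ne_zero _ hp.ne_zero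
  generalize hv : N.factorization p = v at *
  generalize he : Nat.factorization 24 p = e at *
  have hpN : (p : ℤ) ^ v ∣ N := by exact_mod_cast Dvd.intro n hN.symm
  obtain ⟨-, hcc, -⟩ := basic_dvd_of_mem_Norm hM h
  have hc2 : (p : ℤ) ^ v ∣ c * c := (hpN.mul_left _).trans hcc
  have hc1 := pow_half_dvd_of_dvd_mul_self hp hc2
  have hpc : (p : ℤ) ∣ c := (dvd_pow_self _ (by omega)).trans hc1
  have hpa : ¬ (p : ℤ) ∣ a := fun ha => not_dvd_of_isCoprime hp hpD
    (dvd_sub (ha.mul_right d) (hpc.mul_left b))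
  have hpd : ¬ (p : ℤ) ∣ d := fun hd => not_dvd_of_isCoprime hp hpD
    (dvd_sub (hd.mul_left a) (hpc.mul_left b))
  obtain ⟨x, u, hxN, hx, hu⟩ := exists_isCoprime_sq_sub_one (N := N) hp
  rw [he] at hx
  have hce : (p : ℤ) ^ v ∣ c * p ^ e := by
    have h1 := (hpN.mul_left _).trans (dvd_mul_sq_sub_one_of_mem_Norm hM h hxN).1
    rw [hx, show c * d * ((p : ℤ) ^ e * u) = c * p ^ e * (d * u) by ring] at h1
    exact ((isCoprime_of_not_dvd hp hpd).mul_right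
      (isCoprime_of_not_dvd hp hu)).pow_left.dvd_of_dvd_mul_right h1
  -- The two bounds on `c` combine to divisibility by `p ^ v / h`, where `h` is the width.
  have hcμ : (p : ℤ) ^ (v - min e (v / 2)) ∣ c := by
    rcases le_total e (v / 2) with hle | hle
    · rw [min_eq_left hle]; exact pow_sub_dvd_of_dvd_mul_pow hp hce
    · rw [min_eq_right hle, show v - v / 2 = (v + 1) / 2 by omega]; exact hc1
  generalize hμ : min e (v / 2) = μ at *
  have hμv : μ + (v - μ) = v := by omega
  obtain ⟨c', hc'⟩ := hcμ
  have ht : IsCoprime ((p : ℤ) ^ μ) (-(n ^ 2 * γ ^ 2 * a) + n * α * γ * c) := by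
    refine (isCoprime_of_not_dvd hp fun hd => ?_).pow_left
    have := (dvd_add_left (hpc.mul_left _)).mp hd
    rw [dvd_neg] at this
    rcases hpi.dvd_or_dvd this with h1 | h1
    · rcases hpi.dvd_or_dvd h1 with h1 | h1
      · exact hpn (hpi.dvd_of_dvd_pow h1)
      · exact hpγ (hpi.dvd_of_dvd_pow h1)
    · exact hpa h1
  obtain ⟨k, hk⟩ := exists_dvd_add_mul ht c'
  have hconj := (scales_conj_shift hN (h := p ^ μ) (k := p ^ (v - μ)) (by rw [← pow_add, hμv])
    hm0 hdet hWS k).mul h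
  refine ⟨_, conj_shift_mem_closure _ _ k, _, _, _, _, _, hconj, ?_, ?_⟩
  · rw [hv, show (p : ℤ) ^ v = p ^ (v - μ) * p ^ μ by rw [← pow_add, add_comm, hμv]]
    refine (mul_dvd_mul_left _ hk).trans (dvd_of_eq ?_)
    push_cast
    linear_combination -hc'
  · convert hpD using 1
    ring

/-- Every element of the normalizer satisfies the local condition at `p` after multiplication by
an element of the group generated by the Atkin–Lehner matrix and the translation at `p`. -/
theorem exists_mul_mem_localGamma0 (hp : p.Prime)
    (hW : IsAtkinLehner N (p ^ N.factorization p) W) (hM : M ∈ Norm N) :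
    ∃ f ∈ Subgroup.closure {W, shift (width N p)}, f * M ∈ localGamma0 N p := by
  have hpi := Nat.prime_iff_prime_int.mp hp
  have hpow0 : ∀ i : ℕ, (p : ℤ) ^ i ≠ 0 := fun i => pow_ne_zero i (by exact_mod_cast hp.ne_zero)
  obtain ⟨r₀, a₀, b₀, c₀, d₀, hr₀, h₀⟩ := exists_scales_of_mem_Norm hM
  obtain ⟨r, a, b, c, d, x₁, x₂, x₃, x₄, hr, h, hbez⟩ := h₀.exists_primitive hr₀
  -- It suffices to reach the shape `[h a', b'; h² c', h d']` treated above, `h` being the width.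
  have hfin : ∀ g ∈ Subgroup.closure {W, shift (width N p)}, ∀ r' : ℝ, ∀ a' b' c' d' : ℤ,
      Scales (g * M) r' (width N p * a') b' (width N p * width N p * c') (width N p * d') →
      IsCoprime (p : ℤ) (a' * d' - b' * c') → ¬ (p : ℤ) ∣ d' →
      ∃ f ∈ Subgroup.closure {W, shift (width N p)}, f * M ∈ localGamma0 N p := by
    intro g hg r' a' b' c' d' hS hdet hd'
    have hcop : IsCoprime (width N p : ℤ) d' := by
      rw [width_eq_pow hp]; push_cast; exact (isCoprime_of_not_dvd hp hd').pow_left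
    obtain ⟨i, r₁, a₁, b₁, c₁, d₁, hS₁, hdet₁⟩ :=
      exists_shift_mul_scales (width_ne_zero N p) hS hdet hcop
    have hs : shift (width N p) ∈ Subgroup.closure {W, shift (width N p)} :=
      Subgroup.subset_closure (by simp)
    have hle : Subgroup.closure {W, shift (width N p)} ≤ Norm N := by
      rw [Subgroup.closure_le]
      rintro _ (rfl | rfl)
      · exact hW.mem_Norm
      · exact shift_mem_Norm (width_dvd N p) (width_sq_dvd N p)
    obtain ⟨f, hf, hfM⟩ := exists_mul_mem_localGamma0_of_unit hp hW
      (mul_mem (zpow_mem (hle hs) i) (mul_mem (hle hg) hM)) hS₁ hdet₁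
    exact ⟨f * (shift (width N p) ^ i * g), mul_mem hf (mul_mem (zpow_mem hs i) hg), by
      simpa only [mul_assoc] using hfM⟩
  have hD0 : a * d - b * c ≠ 0 := fun h0 => by
    have := h.sq
    rw [h0, Int.cast_zero] at this
    exact hr (pow_eq_zero_iff two_ne_zero |>.mp this)
  obtain ⟨δ, D', hD', hD⟩ : ∃ δ : ℕ, ∃ D' : ℤ, ¬ (p : ℤ) ∣ D' ∧ a * d - b * c = p ^ δ * D' := by
    obtain ⟨D', hD, hD'⟩ := (Int.finiteMultiplicity_iff.mpr
      ⟨by simpa using hp.ne_one, hD0⟩ : FiniteMultiplicity (p : ℤ) _).exists_eq_pow_mul_and_not_dvd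
    exact ⟨_, D', hD', hD⟩
  rcases Nat.eq_zero_or_pos δ with rfl | hδ
  · refine exists_mul_mem_localGamma0_of_unit hp hW hM h ?_
    rw [hD, pow_zero, one_mul]; exact isCoprime_of_not_dvd hp hD'
  rw [width_eq_pow hp] at *
  generalize hv : N.factorization p = v at *
  generalize he : Nat.factorization 24 p = e at *
  have hpN : (p : ℤ) ^ v ∣ N := by rw [← hv]; exact factorization_pow_dvd_cast N p
  obtain ⟨haa, hcc, -, hbb, -⟩ := basic_dvd_of_mem_Norm hM h
  obtain ⟨hdd, -⟩ := basic_dvd_of_mem_Norm (inv_mem hM) h.inv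
  obtain ⟨x, u, hxN, hx, hu⟩ := exists_isCoprime_sq_sub_one (N := N) hp
  have hab := (dvd_mul_sq_sub_one_of_mem_Norm hM h hxN).2
  have hdb := (dvd_mul_sq_sub_one_of_mem_Norm (inv_mem hM) h.inv hxN).2
  rw [show d * a - -b * -c = a * d - b * c by ring] at hdd hdb
  have hδD : (p : ℤ) ^ δ ∣ a * d - b * c := hD ▸ dvd_mul_right _ _
  have haa := hδD.trans haa
  have hdd := hδD.trans hdd
  have hcc : (p : ℤ) ^ (v + δ) ∣ c * c := by
    rw [pow_add, mul_comm]; exact (mul_dvd_mul hδD hpN).trans hcc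
  have ha1 := pow_half_dvd_of_dvd_mul_self hp haa
  have hd1 := pow_half_dvd_of_dvd_mul_self hp hdd
  have hc1 := pow_half_dvd_of_dvd_mul_self hp hcc
  have hpa : (p : ℤ) ∣ a := (dvd_pow_self _ (by omega)).trans ha1
  have hpd : (p : ℤ) ∣ d := (dvd_pow_self _ (by omega)).trans hd1
  have hpc : (p : ℤ) ∣ c := (dvd_pow_self _ (by omega)).trans hc1
  -- By primitivity the remaining entry `b` is prime to `p`.
  have hpb : ¬ (p : ℤ) ∣ b := fun hb => hpi.not_isUnit (isUnit_of_dvd_one (by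
    rw [← hbez]
    exact dvd_add (dvd_add (dvd_add (hpa.mul_left _) (hb.mul_left _)) (hpc.mul_left _))
      (hpd.mul_left _)))
  have hcopb := isCoprime_of_not_dvd hp hpb
  have hδv : δ ≤ v := by
    rw [← hv, ← hp.pow_dvd_iff_le_factorization (NeZero.ne N)]
    have := (hcopb.mul_right hcopb).pow_left.dvd_of_dvd_mul_right (hδD.trans hbb)
    exact_mod_cast this
  have hae : (p : ℤ) ^ δ ∣ a * p ^ e := by
    have h1 := hδD.trans hab
    rw [hx, he, show a * b * ((p : ℤ) ^ e * u) = a * p ^ e * (b * u) by ring] at h1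
    exact (hcopb.mul_right (isCoprime_of_not_dvd hp hu)).pow_left.dvd_of_dvd_mul_right h1
  have hde : (p : ℤ) ^ δ ∣ d * p ^ e := by
    have h1 := hδD.trans hdb
    rw [hx, he, show d * -b * ((p : ℤ) ^ e * u) = d * p ^ e * (-b * u) by ring] at h1
    exact (hcopb.neg_right.mul_right (isCoprime_of_not_dvd hp hu)).pow_left.dvd_of_dvd_mul_right h1
  generalize hμ : min e (v / 2) = μ at *
  have hμv : μ + (v - μ) = v := by omega
  by_cases had : (p : ℤ) ^ (δ + 1) ∣ a * d
  · -- The determinant has the same `p`-part as `c`, and `p ^ (v + δ) ∣ c²` gives `δ = v`.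
    -- Multiplication by `W` and division by `p ^ v / h` lead to the required shape.
    have hcδ : (p : ℤ) ^ δ ∣ c := (pow_dvd_pow _ (by omega)).trans hc1
    obtain ⟨c', hc'⟩ := hcδ
    have hpc' : ¬ (p : ℤ) ∣ c' := fun hd => hD' (by
      have h1 : (p : ℤ) ^ (δ + 1) ∣ p ^ δ * D' := by
        rw [← hD, hc', pow_succ]
        refine dvd_sub (by rwa [← pow_succ]) ?_
        exact (mul_dvd_mul_left _ hd).mul_left b
      rw [pow_succ] at h1
      exact Int.dvd_of_mul_dvd_mul_left (hpow0 δ) h1)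
    have hδ' : δ = v := by
      refine le_antisymm hδv ?_
      have h1 : (p : ℤ) ^ (v + δ) ∣ p ^ (δ + δ) * (c' * c') := by
        rw [hc'] at hcc
        refine hcc.trans (dvd_of_eq (by ring))
      have := le_of_prime_pow_dvd hp (fun hd => (hpi.dvd_or_dvd hd).elim hpc' hpc') h1
      omega
    subst hδ'
    have hdμ : (p : ℤ) ^ (δ - μ) ∣ d := by
      rcases le_total e (δ / 2) with hle | hle
      · rw [← hμ, min_eq_left hle]; exact pow_sub_dvd_of_dvd_mul_pow hp hde
      · rw [← hμ, min_eq_right hle, show δ - δ / 2 = (δ + 1) / 2 by omega]; exact hd1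
    have haμ : (p : ℤ) ^ μ ∣ a := (pow_dvd_pow _ (by omega)).trans ha1
    obtain ⟨d', hd'⟩ := hdμ
    obtain ⟨a', ha'⟩ := haμ
    rw [← hv] at hW
    obtain ⟨n, α, β, γ, ε, hN, hpn, hpγ, hdet, hWS⟩ :=
      hW.exists_scales_of_prime hp (by omega)
    rw [hv] at hN hdet hWS
    have hWm : W ∈ Subgroup.closure {W, shift (p ^ μ)} := Subgroup.subset_closure (by simp)
    have hm : (p : ℤ) ^ δ = p ^ μ * p ^ (δ - μ) := by rw [← pow_add, hμv]
    have hNz : (N : ℤ) = p ^ δ * n := by exact_mod_cast hN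
    have hq0 := hpow0 (δ - μ)
    have hm0' := hpow0 δ
    have hpu : ¬ (p : ℤ) ∣ n * γ * b + ε * d := fun hd =>
      (hpi.dvd_or_dvd ((dvd_add_left (hpd.mul_left ε)).mp hd)).elim
        (fun h1 => (hpi.dvd_or_dvd h1).elim hpn hpγ) hpb
    have hWh := hWS.mul h
    simp only [Nat.cast_pow] at hdet hWh hfin
    generalize (p : ℤ) ^ δ = m at *
    generalize (p : ℤ) ^ (δ - μ) = q at *
    generalize (p : ℤ) ^ μ = P at *
    have hDe : D' = a' * d' - b * c' := by
      apply mul_left_cancel₀ hm0'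
      rw [← hD, hc', ha', hd']
      linear_combination (-a' * d') * hm
    refine hfin W hWm _ (α * a + β * c') (P * α * b + β * d') (n * γ * a' + ε * q * c')
      (n * γ * b + ε * d) ((hWh.congr ?_ ?_ ?_ ?_).div hq0) ?_ hpu
    · rw [hc']; linear_combination (α * a + β * c') * hm
    · rw [hd']; linear_combination (α * b) * hm
    · rw [hNz, hc', ha']
      linear_combination (n * γ * P * a' + ε * c' * (m + P * q)) * hm
    · rw [hNz]; linear_combination (n * γ * b + ε * d) * hm
    · convert isCoprime_of_not_dvd hp hD' using 1
      rw [hDe, ha', hd']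
      linear_combination (a' * d' - b * c') * hdet - α * ε * (a' * d' - b * c') * hm
  · -- The determinant has the same `p`-part as `a d`; the divisibilities of `a²` and `d²` force
    -- `δ = 2 k` with `a` and `d` exactly divisible by `p ^ k`, and `k` is at most the exponent of
    -- `p` in the width.
    have h2 : ∃ k, δ = k + k := by
      by_contra hodd
      have hodd' : δ % 2 = 1 := by
        by_contra h0; exact hodd ⟨δ / 2, by omega⟩
      refine had ((pow_dvd_pow _ (by omega : δ + 1 ≤ (δ + 1) / 2 + (δ + 1) / 2)).trans ?_)
      rw [pow_add]; exact mul_dvd_mul ha1 hd1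
    obtain ⟨k, rfl⟩ := h2
    rw [show (k + k + 1) / 2 = k by omega] at ha1 hd1
    obtain ⟨a', ha'⟩ := ha1
    obtain ⟨d', hd'⟩ := hd1
    have hpa' : ¬ (p : ℤ) ∣ a' := fun hd => had (by
      rw [ha', hd', pow_succ, pow_add]
      exact (mul_dvd_mul_left _ (hd.mul_right d')).trans (dvd_of_eq (by ring)))
    have hpd' : ¬ (p : ℤ) ∣ d' := fun hd => had (by
      rw [ha', hd', pow_succ, pow_add]
      exact (mul_dvd_mul_left _ (hd.mul_left a')).trans (dvd_of_eq (by ring)))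
    have hke : k + k ≤ k + e := by
      refine le_of_prime_pow_dvd hp hpa' (hae.trans (dvd_of_eq ?_))
      rw [ha', pow_add]; ring
    have hkμ : k ≤ μ := by omega
    have hcμ : (p : ℤ) ^ (μ + k) ∣ c := (pow_dvd_pow _ (by omega)).trans hc1
    obtain ⟨c', hc'⟩ := hcμ
    have hP : (p : ℤ) ^ μ = p ^ (μ - k) * p ^ k := by rw [← pow_add]; congr 1; omega
    have hk0 := hpow0 k
    have hh := h.smul ((p : ℤ) ^ (μ - k))
    simp only [pow_add] at hD hc'
    simp only [Nat.cast_pow] at hfin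
    generalize (p : ℤ) ^ (μ - k) = q at *
    generalize (p : ℤ) ^ μ = P at *
    generalize (p : ℤ) ^ k = K at *
    have hDe : D' = a' * d' - q * b * c' := by
      apply mul_left_cancel₀ (mul_ne_zero hk0 hk0)
      rw [← hD, hc', ha', hd', hP]
      ring
    refine hfin 1 (one_mem _) _ a' (q * b) c' d' (by
      rw [one_mul]
      refine hh.congr ?_ rfl ?_ ?_
      · rw [ha', hP]; ring
      · rw [hc', hP]; ring
      · rw [hd', hP]; ring) ?_ hpd'
    rw [← hDe]; exact isCoprime_of_not_dvd hp hD'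

end Reduction

/-! ### Relations between Atkin–Lehner matrices and translations -/

/-- The Cayley–Hamilton theorem for the third power. -/
theorem scales_pow_three {X : SL(2, ℝ)} {r : ℝ} {A B C D t Δ : ℤ} (h : Scales X r A B C D)
    (ht : A + D = t) (hΔ : A * D - B * C = Δ) :
    Scales (X ^ 3) (r ^ 3) ((t ^ 2 - Δ) * A - t * Δ) ((t ^ 2 - Δ) * B) ((t ^ 2 - Δ) * C)
      ((t ^ 2 - Δ) * D - t * Δ) := by
  subst ht hΔ
  have := (h.mul h).mul h
  rw [show X * X * X = X ^ 3 by simp only [pow_succ, pow_zero, one_mul],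
    show r * r * r = r ^ 3 by ring] at this
  refine this.congr ?_ ?_ ?_ ?_ <;> ring

/-- The Cayley–Hamilton theorem for the fourth power. -/
theorem scales_pow_four {X : SL(2, ℝ)} {r : ℝ} {A B C D t Δ : ℤ} (h : Scales X r A B C D)
    (ht : A + D = t) (hΔ : A * D - B * C = Δ) :
    Scales (X ^ 4) (r ^ 4) ((t ^ 3 - 2 * t * Δ) * A - (t ^ 2 - Δ) * Δ) ((t ^ 3 - 2 * t * Δ) * B)
      ((t ^ 3 - 2 * t * Δ) * C) ((t ^ 3 - 2 * t * Δ) * D - (t ^ 2 - Δ) * Δ) := by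
  subst ht hΔ
  have := ((h.mul h).mul h).mul h
  rw [show X * X * X * X = X ^ 4 by simp only [pow_succ, pow_zero, one_mul],
    show r * r * r * r = r ^ 4 by ring] at this
  refine this.congr ?_ ?_ ?_ ?_ <;> ring

/-- Units modulo a divisor of `24` are their own inverses. -/
theorem dvd_sq_sub_one_of_dvd_24 {h : ℕ} (h24 : h ∣ 24) {t : ℤ} (ht : IsCoprime (h : ℤ) t) :
    (h : ℤ) ∣ t ^ 2 - 1 := by
  obtain ⟨u, s, hus⟩ := ht
  have h1 := dvd_sub_of_dvd_24 h24 (a := t) (d := s) ⟨-u, by linear_combination hus⟩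
  have h2 : (h : ℤ) ∣ t * (t - s) - h * u := dvd_sub (h1.mul_left t) (dvd_mul_right _ _)
  exact h2.trans (dvd_of_eq (by linear_combination -hus))

section Relations

variable {N m n h : ℕ} {W : SL(2, ℝ)} {a b c d : ℤ}

theorem IsAtkinLehner.mul_self_mem [NeZero N] (hW : IsAtkinLehner N m W) : W * W ∈ Gamma0R N := by
  obtain ⟨n, a, b, c, d, hN, hm, -, -, -, hS⟩ := hW.exists_scales
  have h1 := hS.mul hS
  rw [Real.mul_self_sqrt (by positivity)] at h1
  have hN' : (N : ℤ) = m * n := by exact_mod_cast hN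
  refine Scales.mem_Gamma0R (k := m) (a := m * a ^ 2 + n * b * c) (b := a * b + b * d)
    (c := c * a + d * c) (d := n * b * c + m * d ^ 2) (by exact_mod_cast hm) ?_
  rw [Int.cast_natCast]
  refine h1.congr ?_ ?_ ?_ ?_
  · linear_combination (b * c) * hN'
  · ring
  · ring
  · linear_combination (b * c) * hN'

theorem shift_pow_mem (hh : h ≠ 0) : shift h ^ h ∈ Gamma0R N := by
  have h1 := scales_shift_zpow hh h
  rw [zpow_natCast] at h1
  refine Scales.mem_Gamma0R (k := h) (a := 1) (b := 1) (c := 0) (d := 1) (by exact_mod_cast hh) ?_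
  rw [Int.cast_natCast]
  exact h1.congr (by ring) (by ring) (by ring) (by ring)

/-- By the Cayley–Hamilton theorem `X³ = (t² - 1) X - t` for `X = W Sʲ` with trace `t`, and
`t² - 1` is divisible by `h` because `h` divides `24`. -/
theorem mul_shift_pow_three_mem (hh : h ≠ 0) (h24 : h ∣ 24) (hN : N = m * n) (hm : m = h * h)
    (hdet : (m : ℤ) * a * d - n * b * c = 1)
    (hW : Scales W (Real.sqrt m) (m * a) b (N * c) (m * d)) {j : ℤ}
    (hj : IsCoprime (h : ℤ) (n * c * j)) : (W * shift h ^ j) ^ 3 ∈ Gamma0R N := by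
  have hh' : (h : ℤ) ≠ 0 := by exact_mod_cast hh
  have hmz : (m : ℤ) = h * h := by exact_mod_cast hm
  have hNz : (N : ℤ) = h * h * n := by rw [hN]; push_cast; rw [hmz]
  have hs : Real.sqrt (m : ℝ) = h := by
    rw [hm, Nat.cast_mul, Real.sqrt_mul_self (by positivity)]
  rw [hmz] at hdet
  have h1 := hW.mul (scales_shift_zpow hh j)
  rw [hs] at h1
  have h2 : Scales (W * shift h ^ j) h (h * h * a) (h * a * j + b) (N * c)
      (h * (n * c * j + h * d)) := by
    have := (h1.congr (a₁ := h * (h * h * a)) (b₁ := h * (h * a * j + b)) (c₁ := h * (N * c))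
      (d₁ := h * (h * (n * c * j + h * d))) ?_ ?_ ?_ ?_).div hh'
    · rw [Int.cast_natCast] at this
      rwa [mul_div_assoc, div_self (by exact_mod_cast hh), mul_one] at this
    · rw [hmz]; ring
    · rw [hmz]; ring
    · ring
    · rw [hNz, hmz]; ring
  obtain ⟨t, ht⟩ : ∃ t, t = h * a + (n * c * j + h * d) := ⟨_, rfl⟩
  obtain ⟨q, hq⟩ := dvd_sq_sub_one_of_dvd_24 h24 (t := t) (by
    rw [ht, show h * a + (n * c * j + h * d) = n * c * j + h * (a + d) by ring]
    exact hj.add_mul_left_right _)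
  have h3 := scales_pow_three h2 (t := h * t) (Δ := h * h) (by rw [ht]; ring)
    (by rw [hNz]; linear_combination (h * h : ℤ) * hdet)
  refine Scales.mem_Gamma0R (k := (h : ℤ) ^ 3) (a := q * (h * h * a) - t)
    (b := q * (h * a * j + b)) (c := q * c) (d := q * (h * (n * c * j + h * d)) - t)
    (pow_ne_zero _ hh') ?_
  push_cast
  have hq' : ((h : ℤ) * t) ^ 2 - h * h = h ^ 3 * q := by linear_combination (h * h : ℤ) * hq
  rw [hq'] at h3
  refine h3.congr ?_ ?_ ?_ ?_ <;> ring

/-- By the Cayley–Hamilton theorem `X⁴ = (t³ - 2 t) X - (t² - 1)` for `X = W S` with trace `t`.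
Here `t = √2 s` with `s` prime to `h`. -/
theorem mul_shift_pow_four_mem (hh : h ≠ 0) (h24 : h ∣ 24) (hN : N = m * n) (hm : m = 2 * (h * h))
    (hdet : (m : ℤ) * a * d - n * b * c = 1)
    (hW : Scales W (Real.sqrt m) (m * a) b (N * c) (m * d))
    (hj : IsCoprime (h : ℤ) (n * c)) : (W * shift h) ^ 4 ∈ Gamma0R N := by
  have hh' : (h : ℤ) ≠ 0 := by exact_mod_cast hh
  have hhR : (h : ℝ) ≠ 0 := by exact_mod_cast hh
  have hmz : (m : ℤ) = 2 * (h * h) := by exact_mod_cast hm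
  have hNz : (N : ℤ) = 2 * (h * h) * n := by rw [hN]; push_cast; rw [hmz]
  have hs : Real.sqrt (m : ℝ) ^ 4 = (((2 * (h * h)) ^ 2 : ℤ) : ℝ) := by
    rw [show Real.sqrt (m : ℝ) ^ 4 = (Real.sqrt m ^ 2) ^ 2 by ring, Real.sq_sqrt (by positivity),
      hm]
    push_cast; ring
  rw [hmz] at hdet
  have h1 := hW.mul (scales_shift_zpow hh 1)
  rw [zpow_one] at h1
  have h2 : Scales (W * shift h) (Real.sqrt m) (2 * (h * h) * a) (2 * h * a + b) (N * c)
      (2 * h * (n * c + h * d)) := by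
    have := (h1.congr (a₁ := h * (2 * (h * h) * a)) (b₁ := h * (2 * h * a + b)) (c₁ := h * (N * c))
      (d₁ := h * (2 * h * (n * c + h * d))) ?_ ?_ ?_ ?_).div hh'
    · rw [Int.cast_natCast] at this
      rwa [mul_div_assoc, div_self hhR, mul_one] at this
    · rw [hmz]; ring
    · rw [hmz]; ring
    · ring
    · rw [hNz, hmz]; ring
  obtain ⟨s, hs'⟩ : ∃ s, s = h * a + (n * c + h * d) := ⟨_, rfl⟩
  obtain ⟨q, hq⟩ := dvd_sq_sub_one_of_dvd_24 h24 (t := s) (by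
    rw [hs', show h * a + (n * c + h * d) = n * c + h * (a + d) by ring]
    exact hj.add_mul_left_right _)
  have h3 := scales_pow_four h2 (t := 2 * h * s) (Δ := 2 * (h * h)) (by rw [hs']; ring)
    (by rw [hNz]; linear_combination (2 * (h * h) : ℤ) * hdet)
  rw [hs] at h3
  refine Scales.mem_Gamma0R (k := (2 * (h * h)) ^ 2)
    (a := 2 * s * q * (2 * (h * h) * a) - (2 * s ^ 2 - 1))
    (b := 2 * s * q * (2 * h * a + b)) (c := 2 * s * q * c)
    (d := 2 * s * q * (2 * h * (n * c + h * d)) - (2 * s ^ 2 - 1))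
    (pow_ne_zero _ (mul_ne_zero two_ne_zero (mul_ne_zero hh' hh'))) ?_
  have hq' : (2 * (h : ℤ) * s) ^ 3 - 2 * (2 * h * s) * (2 * (h * h)) =
      (2 * (h * h)) ^ 2 * (2 * s * q) := by
    linear_combination (8 * h ^ 3 * s : ℤ) * hq
  rw [hq'] at h3
  refine h3.congr ?_ ?_ ?_ ?_ <;> ring

/-- A translation commutes with its Atkin–Lehner conjugate modulo `Γ₀(N)` when `h³` divides `m`.
The condition on `m` enters through the upper right entry of the commutator. -/
theorem commutator_conj_shift_mem {k l : ℕ} (hh : h ≠ 0) (hN : N = m * n) (hm : m = h * k)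
    (hk : k = h * h * l) (hm0 : m ≠ 0) (hdet : (m : ℤ) * a * d - n * b * c = 1)
    (hW : Scales W (Real.sqrt m) (m * a) b (N * c) (m * d)) :
    W * shift h * W⁻¹ * shift h * ((W * shift h * W⁻¹)⁻¹ * (shift h)⁻¹) ∈ Gamma0R N := by
  have hT := scales_conj_shift hN hm hm0 hdet hW 1
  have hs := scales_shift_zpow hh 1
  rw [zpow_one] at hT hs
  have h1 := (hT.mul hs).mul (hT.inv.mul hs.inv)
  have hkz : (k : ℤ) = h * h * l := by exact_mod_cast hk
  have hNz : (N : ℤ) = h * (h * h * l) * n := by rw [hN, hm, hk]; push_cast; ring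
  refine Scales.mem_Gamma0R (k := (h : ℤ) * h)
    (a := 1 + (1 - k * n * a * c) * (h * l * n ^ 2 * c ^ 2))
    (b := h * l * n * a * c * (k * n * a * c - 2) - (1 - k * n * a * c) * (l * n ^ 2 * c ^ 2))
    (c := -(l * n ^ 3 * c ^ 4))
    (d := 1 + h ^ 2 * l ^ 2 * n ^ 4 * c ^ 4 - h * l * n ^ 2 * c ^ 2 * (1 - k * n * a * c))
    (by exact_mod_cast mul_ne_zero hh hh) ?_
  push_cast
  rw [one_mul, one_mul] at h1
  refine h1.congr ?_ ?_ ?_ ?_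
  all_goals rw [hkz]
  · ring
  · ring
  · rw [hNz]; ring
  · ring

/-- The relator of length twelve at `2⁸`, written with `w⁻¹` in two of the places of `w`. In terms
of `z = n² c²`, the upper right and lower left entries have the required divisibility because `z` is
odd. -/
theorem octic_relator_mem (hN : N = m * n) (hm : m = 8 * 32)
    (hdet : (m : ℤ) * a * d - n * b * c = 1)
    (hW : Scales W (Real.sqrt m) (m * a) b (N * c) (m * d)) (hnc : ¬ (2 : ℤ) ∣ n * c) :
    W * shift 8 ^ (1 : ℤ) * W⁻¹ * shift 8 ^ (1 : ℤ) *
      (W * shift 8 ^ (3 : ℤ) * W⁻¹ * shift 8 ^ (3 : ℤ)) ∈ Gamma0R N := by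
  have hm0 : m ≠ 0 := by omega
  have hT := scales_conj_shift hN hm hm0 hdet hW
  have hs := scales_shift_zpow (h := 8) (by norm_num)
  have h1 := ((hT 1).mul (hs 1)).mul ((hT 3).mul (hs 3))
  have hNz : (N : ℤ) = 256 * n := by rw [hN, hm]; push_cast; ring
  obtain ⟨x, hx⟩ : ∃ x, x = n * a * c := ⟨_, rfl⟩
  obtain ⟨z, hz⟩ : ∃ z, z = n ^ 2 * c ^ 2 := ⟨_, rfl⟩
  obtain ⟨q, hq⟩ : ∃ q, z = 2 * q + 1 := by
    have : Odd (n * c) := by rwa [← Int.not_even_iff_odd, even_iff_two_dvd]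
    rw [hz, ← mul_pow]
    exact this.pow
  refine Scales.mem_Gamma0R (k := 64)
    (a := (1 - 32 * x) * (1 - 96 * x) - ((1 - 32 * x) + 256 * a ^ 2) * (12 * z))
    (b := (1 - 32 * x) * (-4 - 24 * x - 9 * q) + 96 * (1 - 32 * x) * a ^ 2
      - 36 * (32 * a ^ 2) * z + 32 * a ^ 2 * (1 + 96 * x))
    (c := n * c ^ 2 * (3 * q + 1))
    (d := -4 * z * (3 * (1 - 96 * x) + 24 * (32 * a ^ 2)) +
      (-4 * z + 1 + 32 * x) * (-36 * z + 1 + 96 * x)) (by norm_num) ?_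
  have hr : (1 * ((8 : ℕ) : ℝ) * (1 * ((8 : ℕ) : ℝ))) = ((64 : ℤ) : ℝ) := by norm_num
  rw [hr] at h1
  refine h1.congr ?_ ?_ ?_ ?_
  · push_cast; rw [hz, hx]; ring
  · push_cast
    have hq' : n ^ 2 * c ^ 2 = 2 * q + 1 := by rw [← hz, hq]
    rw [hz, hx]
    linear_combination (-288 * (1 - 32 * (n * a * c))) * hq'
  · push_cast
    have hq' : n ^ 2 * c ^ 2 = 2 * q + 1 := by rw [← hz, hq]
    rw [hNz]
    linear_combination (64 * 384 * n ^ 2 * c ^ 2 : ℤ) * hq'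
  · push_cast; rw [hz, hx]; ring

/-! ### Nontriviality of normal forms -/

/-- The lower left entry of `Sⁱ W Sʲ W⁻¹` shows `h ∣ j`, and then the upper right one `h ∣ i`. -/
theorem dvd_of_shift_conj_shift_mem {p k : ℕ} (hp : p.Prime) {e : ℕ} (hh : h = p ^ e)
    (hN : N = m * n) (hm : m = h * k) (hm0 : m ≠ 0)
    (hdet : (m : ℤ) * a * d - n * b * c = 1)
    (hW : Scales W (Real.sqrt m) (m * a) b (N * c) (m * d)) (hpn : ¬ (p : ℤ) ∣ n)
    (hpc : ¬ (p : ℤ) ∣ c) {i j : ℤ}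
    (hmem : shift h ^ i * (W * shift h ^ j * W⁻¹) ∈ Gamma0R N) :
    (h : ℤ) ∣ i ∧ (h : ℤ) ∣ j := by
  have hh0 : h ≠ 0 := by rintro rfl; simp at hm; exact hm0 hm
  have hhR : (h : ℝ) ≠ 0 := by exact_mod_cast hh0
  have hk0 : (k : ℤ) ≠ 0 := by
    have : k ≠ 0 := by rintro rfl; simp at hm; exact hm0 hm
    exact_mod_cast this
  have hn0 : (n : ℤ) ≠ 0 := fun h0 => hpn (h0 ▸ dvd_zero _)
  obtain ⟨a', b', c', d', -, h2, h3, -⟩ := Scales.of_mem_Gamma0R hmem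
    ((scales_shift_zpow hh0 i).mul (scales_conj_shift hN hm hm0 hdet hW j))
  have h2' : (h : ℤ) * b' = h * (j * k * a ^ 2) + i * (1 + j * k * n * a * c) := by
    rw [mul_one] at h2; exact_mod_cast h2
  have h3' : (h : ℤ) * (N * c') = 0 * (1 - j * k * n * a * c) + h * -(j * k * n ^ 2 * c ^ 2) := by
    rw [mul_one] at h3; exact_mod_cast h3
  have hcop : IsCoprime (h : ℤ) (n * c ^ 2) := by
    rw [hh]; push_cast
    exact ((isCoprime_of_not_dvd hp hpn).mul_right (isCoprime_of_not_dvd hp hpc).pow_right).pow_left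
  have hj : (h : ℤ) ∣ j := by
    refine hcop.dvd_of_dvd_mul_right ⟨-c', ?_⟩
    have hhz : (h : ℤ) ≠ 0 := by exact_mod_cast hh0
    apply mul_left_cancel₀ (mul_ne_zero hhz (mul_ne_zero hk0 hn0))
    rw [hN, hm] at h3'
    push_cast at h3'
    linear_combination h3'
  refine ⟨?_, hj⟩
  obtain ⟨j', rfl⟩ := hj
  exact ⟨b' - h * j' * k * a ^ 2 - i * j' * k * n * a * c, by linear_combination -h2'⟩

/-- The lower left entry `N c / √m` of `Sⁱ W Sʲ` is not a multiple of `N`. -/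
theorem shift_mul_shift_not_mem {p : ℕ} (hp : p.Prime) (hh0 : h ≠ 0) (hN0 : N ≠ 0)
    (hpm : p ∣ m) (hW : Scales W (Real.sqrt m) (m * a) b (N * c) (m * d)) (hpc : ¬ (p : ℤ) ∣ c)
    (i j : ℤ) : shift h ^ i * W * shift h ^ j ∉ Gamma0R N := by
  intro hmem
  have hhR : (h : ℝ) ≠ 0 := by exact_mod_cast hh0
  have hNR : (N : ℝ) ≠ 0 := by exact_mod_cast hN0
  obtain ⟨a', b', c', d', -, -, h3, -⟩ := Scales.of_mem_Gamma0R hmem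
    (((scales_shift_zpow hh0 i).mul hW).mul (scales_shift_zpow hh0 j))
  push_cast at h3
  have h4 : Real.sqrt m * c' = c := by
    apply mul_left_cancel₀ (mul_ne_zero (mul_ne_zero hhR hhR) hNR)
    linear_combination h3
  have h5 : (m : ℤ) * c' ^ 2 = c ^ 2 := by
    have : (m : ℝ) * c' ^ 2 = c ^ 2 := by
      rw [← h4, mul_pow, Real.sq_sqrt (by positivity)]
    exact_mod_cast this
  refine hpc ((Nat.prime_iff_prime_int.mp hp).dvd_of_dvd_pow (n := 2) ?_)
  rw [← h5]
  exact Dvd.dvd.mul_right (by exact_mod_cast hpm) _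

end Relations

/-! ### The quotient group -/

section Quotient

theorem mk_eq_one_iff {N : ℕ} {M : SL(2, ℝ)} (hM : M ∈ Norm N) :
    (QuotientGroup.mk' ((Gamma0R N).subgroupOf (Norm N)) ⟨M, hM⟩ : NormQuot N) = 1 ↔
      M ∈ Gamma0R N :=
  (QuotientGroup.eq_one_iff _).trans Subgroup.mem_subgroupOf

theorem coprime_width {p q : ℕ} (N : ℕ) (hp : p.Prime) (hq : q.Prime) (hpq : p ≠ q) :
    q.Coprime (width N p) := by
  rw [width_eq_pow hp]
  exact ((Nat.coprime_primes hq hp).mpr hpq.symm).pow_right _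

/-- The classes of elements of the normalizer that satisfy the local condition at `p`. -/
def localClasses (N p : ℕ) : Subgroup (NormQuot N) :=
  ((localGamma0 N p).subgroupOf (Norm N)).map (QuotientGroup.mk' _)

theorem mk_mem_localClasses {N p : ℕ} {M : SL(2, ℝ)} (hM : M ∈ Norm N) :
    (QuotientGroup.mk' ((Gamma0R N).subgroupOf (Norm N)) ⟨M, hM⟩ : NormQuot N) ∈
      localClasses N p ↔ M ∈ localGamma0 N p := by
  constructor
  · rintro ⟨x, hloc, he⟩
    have h1 : QuotientGroup.mk' ((Gamma0R N).subgroupOf (Norm N)) (x⁻¹ * ⟨M, hM⟩) = 1 := by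
      rw [map_mul, map_inv, he, inv_mul_cancel]
    have h2 := (mk_eq_one_iff (x⁻¹ * ⟨M, hM⟩ : Norm N).2).mp h1
    have := mul_mem (Subgroup.mem_subgroupOf.mp hloc) (Gamma0R_le_localGamma0 N p h2)
    rwa [← Subgroup.coe_mul, mul_inv_cancel_left] at this
  · exact fun h => ⟨⟨M, hM⟩, Subgroup.mem_subgroupOf.mpr h, rfl⟩

variable {N p : ℕ} [NeZero N] {W : SL(2, ℝ)}

theorem atkinLehnerClass_eq {m : ℕ} (hW : IsAtkinLehner N m W) : atkinLehnerClass hW =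
    QuotientGroup.mk' ((Gamma0R N).subgroupOf (Norm N)) ⟨W, hW.mem_Norm⟩ := rfl

theorem shiftClass_eq (N p : ℕ) [NeZero N] : shiftClass N p =
    QuotientGroup.mk' ((Gamma0R N).subgroupOf (Norm N))
      ⟨shift (width N p), shift_mem_Norm (width_dvd N p) (width_sq_dvd N p)⟩ := rfl

theorem closure_le_localClasses {q : ℕ} (hp : p.Prime) (hq : q.Prime) (hpq : p ≠ q)
    (hW : IsAtkinLehner N (p ^ N.factorization p) W) :
    Subgroup.closure {atkinLehnerClass hW, shiftClass N p} ≤ localClasses N q := by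
  rw [Subgroup.closure_le]
  rintro _ (rfl | rfl)
  · exact (mk_mem_localClasses _).mpr
      (hW.mem_localGamma0 (((Nat.coprime_primes hq hp).mpr hpq.symm).pow_right _))
  · exact (mk_mem_localClasses _).mpr
      (shift_mem_localGamma0 (width_ne_zero N p) (coprime_width N hp hq hpq))

theorem exists_mul_mem_localClasses (hp : p.Prime)
    (hW : IsAtkinLehner N (p ^ N.factorization p) W) (g : NormQuot N) :
    ∃ f ∈ Subgroup.closure {atkinLehnerClass hW, shiftClass N p}, f * g ∈ localClasses N p := by
  obtain ⟨⟨M, hM⟩, rfl⟩ := QuotientGroup.mk'_surjective _ g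
  obtain ⟨f, hf, hfM⟩ := exists_mul_mem_localGamma0 hp hW hM
  let W' : Norm N := ⟨W, hW.mem_Norm⟩
  let S' : Norm N := ⟨shift (width N p), shift_mem_Norm (width_dvd N p) (width_sq_dvd N p)⟩
  have h1 : (Subgroup.closure {W', S'}).map (Norm N).subtype =
      Subgroup.closure {W, shift (width N p)} := by
    rw [MonoidHom.map_closure, Set.image_pair]; rfl
  have h2 : (Subgroup.closure {W', S'}).map
      (QuotientGroup.mk' ((Gamma0R N).subgroupOf (Norm N))) =
      Subgroup.closure {atkinLehnerClass hW, shiftClass N p} := by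
    rw [MonoidHom.map_closure, Set.image_pair]; rfl
  rw [← h1] at hf
  obtain ⟨f', hf', rfl⟩ := hf
  refine ⟨QuotientGroup.mk' _ f', h2 ▸ Subgroup.mem_map_of_mem _ hf', ?_⟩
  rw [← map_mul]
  exact (mk_mem_localClasses (f' * ⟨M, hM⟩).2).mpr hfM

/-- An element of the normalizer satisfies the local condition at every prime not dividing `N`. -/
theorem mem_localGamma0_of_not_dvd {M : SL(2, ℝ)} (hp : p.Prime) (hpN : ¬ p ∣ N)
    (hM : M ∈ Norm N) (hW : IsAtkinLehner N (p ^ N.factorization p) W) :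
    M ∈ localGamma0 N p := by
  obtain ⟨f, hf, hfM⟩ := exists_mul_mem_localGamma0 hp hW hM
  have hv : N.factorization p = 0 := Nat.factorization_eq_zero_of_not_dvd hpN
  have hle : Subgroup.closure {W, shift (width N p)} ≤ localGamma0 N p := by
    rw [Subgroup.closure_le]
    rintro _ (rfl | rfl)
    · exact hW.mem_localGamma0 (by rw [hv, pow_zero]; exact Nat.coprime_one_right p)
    · refine shift_mem_localGamma0 (width_ne_zero N p) ?_
      rw [width_eq_pow hp, hv, Nat.zero_div, Nat.min_zero, pow_zero]
      exact Nat.coprime_one_right p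
  simpa using mul_mem (inv_mem (hle hf)) hfM

theorem isInternalProduct_closure {W : ℕ → SL(2, ℝ)}
    (hW : ∀ p, IsAtkinLehner N (p ^ N.factorization p) (W p)) :
    IsInternalProduct fun p : N.primeFactors =>
      Subgroup.closure {atkinLehnerClass (hW p), shiftClass N p} := by
  have hprime : ∀ p : N.primeFactors, (p : ℕ).Prime := fun p => Nat.prime_of_mem_primeFactors p.2
  refine isInternalProduct_of_complements (T := fun p : N.primeFactors => localClasses N p) ?_ ?_ ?_
  · exact fun i j hij => closure_le_localClasses (hprime i) (hprime j)
      (fun h => hij (Subtype.ext h)) (hW i)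
  · intro g hg
    obtain ⟨⟨M, hM⟩, rfl⟩ := QuotientGroup.mk'_surjective _ g
    refine (mk_eq_one_iff hM).mpr (mem_Gamma0R_of_forall_mem_localGamma0 fun p hp => ?_)
    by_cases hpN : p ∣ N
    · exact (mk_mem_localClasses hM).mp
        (hg ⟨p, Nat.mem_primeFactors.mpr ⟨hp, hpN, NeZero.ne N⟩⟩)
    · exact mem_localGamma0_of_not_dvd hp hpN hM (hW p)
  · exact fun p g => exists_mul_mem_localClasses (hprime p) (hW p) g

theorem atkinLehnerClass_mul_self {m : ℕ} (hW : IsAtkinLehner N m W) :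
    atkinLehnerClass hW * atkinLehnerClass hW = 1 := by
  rw [atkinLehnerClass_eq, ← map_mul]
  exact (mk_eq_one_iff _).mpr hW.mul_self_mem

theorem atkinLehnerClass_inv {m : ℕ} (hW : IsAtkinLehner N m W) :
    (atkinLehnerClass hW)⁻¹ = atkinLehnerClass hW :=
  inv_eq_of_mul_eq_one_left (atkinLehnerClass_mul_self hW)

theorem shiftClass_pow_width (N p : ℕ) [NeZero N] : shiftClass N p ^ width N p = 1 := by
  rw [shiftClass_eq, ← map_pow]
  exact (mk_eq_one_iff _).mpr (shift_pow_mem (width_ne_zero N p))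

theorem dvd_of_normalForm_eq_one (hp : p.Prime) (hv : N.factorization p ≠ 0)
    (hW : IsAtkinLehner N (p ^ N.factorization p) W) {i j : ℤ}
    (h : shiftClass N p ^ i * atkinLehnerClass hW * shiftClass N p ^ j * atkinLehnerClass hW = 1) :
    (width N p : ℤ) ∣ i ∧ (width N p : ℤ) ∣ j := by
  obtain ⟨n, a, b, c, d, hN, hpn, hpc, hdet, hS⟩ := hW.exists_scales_of_prime hp hv
  have hm0 : p ^ N.factorization p ≠ 0 := pow_ne_zero _ hp.ne_zero
  obtain ⟨k, hk⟩ : width N p ∣ p ^ N.factorization p := by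
    rw [width_eq_pow hp]; exact pow_dvd_pow _ (by omega)
  refine dvd_of_shift_conj_shift_mem hp (width_eq_pow hp N) hN hk hm0 hdet hS hpn hpc ?_
  nth_rewrite 2 [← atkinLehnerClass_inv hW] at h
  rw [atkinLehnerClass_eq, shiftClass_eq, ← map_inv, ← map_zpow, ← map_zpow, ← map_mul, ← map_mul,
    ← map_mul] at h
  have := (mk_eq_one_iff _).mp h
  rw [← mul_assoc, ← mul_assoc]
  exact this

theorem shiftClass_mul_atkinLehnerClass_mul_ne_one (hp : p.Prime) (hv : N.factorization p ≠ 0)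
    (hW : IsAtkinLehner N (p ^ N.factorization p) W) (i j : ℤ) :
    shiftClass N p ^ i * atkinLehnerClass hW * shiftClass N p ^ j ≠ 1 := by
  obtain ⟨n, a, b, c, d, hN, hpn, hpc, hdet, hS⟩ := hW.exists_scales_of_prime hp hv
  intro h
  rw [atkinLehnerClass_eq, shiftClass_eq, ← map_zpow, ← map_zpow, ← map_mul, ← map_mul] at h
  exact shift_mul_shift_not_mem hp (width_ne_zero N p) (NeZero.ne N) (dvd_pow_self p hv) hS hpc i j
    ((mk_eq_one_iff _).mp h)

theorem orderOf_atkinLehnerClass (hp : p.Prime) (hv : N.factorization p ≠ 0)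
    (hW : IsAtkinLehner N (p ^ N.factorization p) W) :
    orderOf (atkinLehnerClass hW) = 2 := by
  refine orderOf_eq_prime (by rw [sq]; exact atkinLehnerClass_mul_self hW) ?_
  simpa using shiftClass_mul_atkinLehnerClass_mul_ne_one hp hv hW 0 0

theorem closure_eq_zpowers (hW : IsAtkinLehner N (p ^ N.factorization p) W)
    (hw : width N p = 1) :
    Subgroup.closure {atkinLehnerClass hW, shiftClass N p} =
      Subgroup.zpowers (atkinLehnerClass hW) := by
  have h1 := shiftClass_pow_width N p
  rw [hw, pow_one] at h1
  rw [h1, Subgroup.zpowers_eq_closure, Set.pair_comm, Subgroup.closure_insert_one]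

theorem atkinLehnerClass_mul_shiftClass_pow_three (hp : p.Prime) (hv : N.factorization p ≠ 0)
    (hW : IsAtkinLehner N (p ^ N.factorization p) W)
    (hm : p ^ N.factorization p = width N p * width N p) {j : ℤ} (hj : ¬ (p : ℤ) ∣ j) :
    (atkinLehnerClass hW * shiftClass N p ^ j) ^ 3 = 1 := by
  obtain ⟨n, a, b, c, d, hN, hpn, hpc, hdet, hS⟩ := hW.exists_scales_of_prime hp hv
  rw [atkinLehnerClass_eq, shiftClass_eq, ← map_zpow, ← map_mul, ← map_pow]
  refine (mk_eq_one_iff _).mpr (mul_shift_pow_three_mem (width_ne_zero N p) (width_dvd N p) hN hm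
    hdet hS ?_)
  rw [width_eq_pow hp]
  push_cast
  exact (((isCoprime_of_not_dvd hp hpn).mul_right (isCoprime_of_not_dvd hp hpc)).mul_right
    (isCoprime_of_not_dvd hp hj)).pow_left

theorem atkinLehnerClass_mul_shiftClass_pow_four (hp : p.Prime) (hv : N.factorization p ≠ 0)
    (hW : IsAtkinLehner N (p ^ N.factorization p) W)
    (hm : p ^ N.factorization p = 2 * (width N p * width N p)) :
    (atkinLehnerClass hW * shiftClass N p) ^ 4 = 1 := by
  obtain ⟨n, a, b, c, d, hN, hpn, hpc, hdet, hS⟩ := hW.exists_scales_of_prime hp hv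
  rw [atkinLehnerClass_eq, shiftClass_eq, ← map_mul, ← map_pow]
  refine (mk_eq_one_iff _).mpr (mul_shift_pow_four_mem (width_ne_zero N p) (width_dvd N p) hN hm
    hdet hS ?_)
  rw [width_eq_pow hp]
  push_cast
  exact ((isCoprime_of_not_dvd hp hpn).mul_right (isCoprime_of_not_dvd hp hpc)).pow_left

theorem commute_conj_shiftClass (hp : p.Prime) (hv : N.factorization p ≠ 0)
    (hW : IsAtkinLehner N (p ^ N.factorization p) W) {l : ℕ}
    (hm : p ^ N.factorization p = width N p * (width N p * width N p * l)) :
    Commute (atkinLehnerClass hW * shiftClass N p * atkinLehnerClass hW) (shiftClass N p) := by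
  obtain ⟨n, a, b, c, d, hN, hpn, hpc, hdet, hS⟩ := hW.exists_scales_of_prime hp hv
  have h1 := commutator_conj_shift_mem (width_ne_zero N p) hN hm rfl (pow_ne_zero _ hp.ne_zero)
    hdet hS
  nth_rewrite 2 [← atkinLehnerClass_inv hW]
  rw [commute_iff_eq, ← mul_inv_eq_one, mul_inv_rev (shiftClass N p), atkinLehnerClass_eq,
    shiftClass_eq, ← map_inv, ← map_inv, ← map_mul, ← map_mul, ← map_mul, ← map_inv, ← map_mul,
    ← map_mul]
  exact (mk_eq_one_iff _).mpr h1

theorem octic_relation (hW : IsAtkinLehner N (2 ^ N.factorization 2) W)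
    (hv : N.factorization 2 = 8) :
    atkinLehnerClass hW * shiftClass N 2 * atkinLehnerClass hW * shiftClass N 2 *
      atkinLehnerClass hW * shiftClass N 2 ^ 3 * atkinLehnerClass hW * shiftClass N 2 ^ 3 = 1 := by
  obtain ⟨n, a, b, c, d, hN, hpn, hpc, hdet, hS⟩ :=
    hW.exists_scales_of_prime Nat.prime_two (by omega)
  have hw : width N 2 = 8 := by simp [width, hv]
  have h1 := octic_relator_mem hN (by rw [hv]; norm_num) hdet hS (fun h =>
    (Int.prime_two.dvd_or_dvd h).elim (by exact_mod_cast hpn) (by exact_mod_cast hpc))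
  simp only [← hw] at h1
  have h2 : atkinLehnerClass hW * shiftClass N 2 ^ (1 : ℤ) * (atkinLehnerClass hW)⁻¹ *
      shiftClass N 2 ^ (1 : ℤ) * (atkinLehnerClass hW * shiftClass N 2 ^ (3 : ℤ) *
      (atkinLehnerClass hW)⁻¹ * shiftClass N 2 ^ (3 : ℤ)) = 1 := by
    rw [atkinLehnerClass_eq, shiftClass_eq]
    simp only [← map_inv, ← map_zpow, ← map_mul]
    exact (mk_eq_one_iff _).mpr h1
  rw [atkinLehnerClass_inv, zpow_one, show (3 : ℤ) = (3 : ℕ) from rfl, zpow_natCast] at h2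
  simpa only [mul_assoc] using h2

end Quotient

/-! ### Presentations -/

/-- If the integers prime to `p` are `±1` modulo `h`, the relation `(x y)³ = 1` implies
`(x yʲ)³ = 1` for all `j` prime to `p`. -/
theorem hasRewriting_of_cube_relators {Q : Type*} [Group Q] {p : ℤ} {h : ℕ} (hp : ¬ p ∣ 1)
    (hh : ∀ j : ℤ, ¬ p ∣ j → j ≡ 1 [ZMOD h] ∨ j ≡ -1 [ZMOD h]) {x y : Q} (hx : x * x = 1)
    (hy : y ^ h = 1) (hxy : (x * y) ^ 3 = 1) : HasRewriting x y := by
  have h1 := mul_zpow_mul_of_cube (j := 1) hx (by rwa [zpow_one])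
  have h2 : x * y ^ (-1 : ℤ) * x = y ^ (1 : ℤ) * x * y ^ (1 : ℤ) := by
    have := congrArg (·⁻¹) h1
    simpa only [mul_inv_rev, inv_eq_of_mul_eq_one_left hx, ← zpow_neg, neg_neg,
      mul_assoc] using this
  refine (HasRewriting.of_cube hp hx fun j hj => ?_).1
  rcases hh j hj with e | e
  · rw [zpow_eq_zpow_of_emod hy e, zpow_eq_zpow_of_emod hy e.neg]; exact h1
  · rw [zpow_eq_zpow_of_emod hy e, zpow_eq_zpow_of_emod hy e.neg, neg_neg]; exact h2

theorem commute_of_pow_four {Q : Type*} [Group Q] {x y : Q} (hx : x * x = 1) (hy : y * y = 1)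
    (hxy : (x * y) ^ 4 = 1) : Commute (x * y * x) y := by
  have hxi : x⁻¹ = x := inv_eq_of_mul_eq_one_left hx
  have hyi : y⁻¹ = y := inv_eq_of_mul_eq_one_left hy
  have h1 : x * y * x * y * (x * y * x * y) = 1 := by
    rw [← hxy]; simp only [pow_succ, pow_zero, one_mul, mul_assoc]
  rw [commute_iff_eq, mul_eq_one_iff_eq_inv.mp h1]
  simp only [mul_inv_rev, hxi, hyi, mul_assoc]

@[simp] theorem lift_letterW {Q : Type*} [Group Q] (x y : Q) :
    FreeGroup.lift ![x, y] letterW = x := by simp [letterW]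

@[simp] theorem lift_letterS {Q : Type*} [Group Q] (x y : Q) :
    FreeGroup.lift ![x, y] letterS = y := by simp [letterS]

/-- Next to `w² = sʰ = 1`, one further relator `r` suffices for a presentation, provided that it
forces the rewriting rule and that the normal forms are trivial only when forced to be. -/
theorem hasDefiningRelators_of_hasRewriting {P : Type*} [Group P] {w s : P} {h : ℕ}
    {r : FreeGroup (Fin 2)} (hw : w * w = 1) (hs : s ^ h = 1)
    (hr : FreeGroup.lift ![w, s] r = 1)
    (hrel : ∀ {Q : Type} [Group Q] (x y : Q), x * x = 1 → y ^ h = 1 →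
      FreeGroup.lift ![x, y] r = 1 → HasRewriting x y)
    (h1 : ∀ i j : ℤ, s ^ i * w * s ^ j * w = 1 → (h : ℤ) ∣ i ∧ (h : ℤ) ∣ j)
    (h2 : ∀ i j : ℤ, s ^ i * w * s ^ j ≠ 1) :
    HasDefiningRelators w s {letterW ^ 2, letterS ^ h, r} := by
  refine hasDefiningRelators_of_normalForm (h := h) ?_ ?_ h1 h2
  · rintro r (rfl | rfl | rfl)
    · rw [map_pow, lift_letterW, sq, hw]
    · rw [map_pow, lift_letterS, hs]
    · exact hr
  · intro Q _ x y h'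
    have r1 := h' _ (Or.inl rfl)
    have r2 := h' _ (Or.inr (Or.inl rfl))
    have r3 := h' _ (Or.inr (Or.inr rfl))
    rw [map_pow, lift_letterW, sq] at r1
    rw [map_pow, lift_letterS] at r2
    exact ⟨r1, r2, hrel x y r1 r2 r3⟩

end Gamma0Normalizer

open Gamma0Normalizer in
theorem mainTheorem1 (N : ℕ) [NeZero N] (W : ℕ → SL(2, ℝ))
    (hW : ∀ p, IsAtkinLehner N (p ^ N.factorization p) (W p)) :
    let w : ℕ → NormQuot N := fun p => atkinLehnerClass (hW p)
    let S : ℕ → NormQuot N := fun p => shiftClass N p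
    let F : ℕ → Subgroup (NormQuot N) := fun p => Subgroup.closure {w p, S p}
    let lam : ℕ := N.factorization 2
    let mu : ℕ := min 3 (lam / 2)
    -- the whole quotient is the product of the local factors
    IsInternalProduct (fun p : N.primeFactors => F p) ∧
    -- primes at least 5
    (∀ q : ℕ, q.Prime → 5 ≤ q → q ∣ N → F q = Subgroup.zpowers (w q) ∧ orderOf (w q) = 2) ∧
    -- the prime 3
    (N.factorization 3 = 0 → F 3 = ⊥) ∧
    (N.factorization 3 = 1 → F 3 = Subgroup.zpowers (w 3) ∧ orderOf (w 3) = 2) ∧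
    (N.factorization 3 = 2 →
      w 3 ^ 2 = 1 ∧ S 3 ^ 3 = 1 ∧ (w 3 * S 3) ^ 3 = 1 ∧ Nat.card (F 3) = 12 ∧
      HasDefiningRelators (w 3) (S 3) {letterW ^ 2, letterS ^ 3, (letterW * letterS) ^ 3}) ∧
    (3 ≤ N.factorization 3 →
      w 3 ^ 2 = 1 ∧ S 3 ^ 3 = 1 ∧ Commute (w 3 * S 3 * w 3) (S 3) ∧ Nat.card (F 3) = 18 ∧
      HasDefiningRelators (w 3) (S 3)
        {letterW ^ 2, letterS ^ 3, ⁅letterW * letterS * letterW, letterS⁆}) ∧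
    -- the prime 2
    (lam = 0 → F 2 = ⊥) ∧
    (lam = 1 → F 2 = Subgroup.zpowers (w 2) ∧ orderOf (w 2) = 2) ∧
    (lam = 2 * mu → 2 ≤ lam → lam ≤ 6 →
      w 2 ^ 2 = 1 ∧ S 2 ^ 2 ^ mu = 1 ∧ (w 2 * S 2) ^ 3 = 1 ∧
      (lam = 2 → Nat.card (F 2) = 6) ∧
      (lam = 4 → Nat.card (F 2) = 24) ∧
      (lam = 6 → Nat.card (F 2) = 96) ∧
      (lam ≤ 4 → HasDefiningRelators (w 2) (S 2)
        {letterW ^ 2, letterS ^ 2 ^ mu, (letterW * letterS) ^ 3})) ∧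
    (2 * mu < lam → 2 ≤ lam → lam ≤ 7 →
      w 2 ^ 2 = 1 ∧ S 2 ^ 2 ^ mu = 1 ∧ (w 2 * S 2) ^ 4 = 1 ∧
      (lam = 3 → HasDefiningRelators (w 2) (S 2)
        {letterW ^ 2, letterS ^ 2, (letterW * letterS) ^ 4})) ∧
    (lam = 8 →
      w 2 ^ 2 = 1 ∧ S 2 ^ 8 = 1 ∧
      w 2 * S 2 * w 2 * S 2 * w 2 * S 2 ^ 3 * w 2 * S 2 ^ 3 = 1 ∧
      HasDefiningRelators (w 2) (S 2)
        {letterW ^ 2, letterS ^ 8,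
          letterW * letterS * letterW * letterS * letterW * letterS ^ 3 * letterW *
            letterS ^ 3}) ∧
    (9 ≤ lam →
      w 2 ^ 2 = 1 ∧ S 2 ^ 8 = 1 ∧ Commute (S 2) (w 2 * S 2 * w 2) ∧
      HasDefiningRelators (w 2) (S 2)
        {letterW ^ 2, letterS ^ 8, ⁅letterS, letterW * letterS * letterW⁆}) := by
  intro w S F lam mu
  have hww : ∀ p, w p * w p = 1 := fun p => atkinLehnerClass_mul_self (hW p)
  have hw2 : ∀ p, w p ^ 2 = 1 := fun p => by rw [sq]; exact hww p
  have hSw : ∀ p, S p ^ width N p = 1 := fun p => shiftClass_pow_width N p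
  have hone : ∀ p : ℕ, p.Prime → width N p = 1 → N.factorization p ≠ 0 →
      F p = Subgroup.zpowers (w p) ∧ orderOf (w p) = 2 := fun p hp h1 hv =>
    ⟨closure_eq_zpowers (hW p) h1, orderOf_atkinLehnerClass hp hv (hW p)⟩
  have hzero : ∀ p : ℕ, p.Prime → N.factorization p = 0 → F p = ⊥ := fun p hp hv => by
    have h1 : width N p = 1 := by rw [width_eq_pow hp, hv, Nat.zero_div, Nat.min_zero, pow_zero]
    have h2 : w p = 1 := (mk_eq_one_iff _).mpr (mem_Gamma0R_of_forall_mem_localGamma0 fun q hq =>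
      (hW p).mem_localGamma0 (by rw [hv, pow_zero]; exact Nat.coprime_one_right q))
    change Subgroup.closure {atkinLehnerClass (hW p), shiftClass N p} = ⊥
    rw [closure_eq_zpowers (hW p) h1, show atkinLehnerClass (hW p) = 1 from h2,
      Subgroup.zpowers_one_eq_bot]
  have h2p : Nat.Prime 2 := Nat.prime_two
  have h3p : Nat.Prime 3 := Nat.prime_three
  have hwidth2 : width N 2 = 2 ^ mu := if_pos rfl
  have hwidth3 : width N 3 = 3 ^ min 1 (N.factorization 3 / 2) := by simp [width]
  have hnf1 := fun (p : ℕ) (hp : p.Prime) (hv : N.factorization p ≠ 0) (i j : ℤ) =>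
    dvd_of_normalForm_eq_one hp hv (hW p) (i := i) (j := j)
  have hnf2 := fun (p : ℕ) (hp : p.Prime) (hv : N.factorization p ≠ 0) (i j : ℤ) =>
    shiftClass_mul_atkinLehnerClass_mul_ne_one hp hv (hW p) i j
  refine ⟨isInternalProduct_closure hW, ?_, hzero 3 h3p, ?_, ?_, ?_, hzero 2 h2p, ?_, ?_, ?_, ?_,
    ?_⟩
  · intro q hq hq5 hqN
    refine hone q hq ?_ (hq.factorization_pos_of_dvd (NeZero.ne N) hqN).ne'
    simp [width, show q ≠ 2 by omega, show q ≠ 3 by omega]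
  · intro hv
    exact hone 3 h3p (by rw [hwidth3, hv]; rfl) (by omega)
  · intro hv
    have hw3 : width N 3 = 3 := by rw [hwidth3, hv]; rfl
    have hv0 : N.factorization 3 ≠ 0 := by omega
    have hS3 : S 3 ^ 3 = 1 := by have := hSw 3; rwa [hw3] at this
    have hcube : ∀ j : ℤ, ¬ ((3 : ℕ) : ℤ) ∣ j → (w 3 * S 3 ^ j) ^ 3 = 1 := fun j hj =>
      atkinLehnerClass_mul_shiftClass_pow_three h3p hv0 (hW 3) (by rw [hw3, hv]; rfl) hj
    have hcube1 : (w 3 * S 3) ^ 3 = 1 := by simpa using hcube 1 (by decide)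
    have hn1 := hnf1 3 h3p hv0
    have hn2 := hnf2 3 h3p hv0
    rw [hw3] at hn1
    refine ⟨hw2 3, hS3, hcube1, ?_, hasDefiningRelators_of_hasRewriting (h := 3) (hww 3) hS3
      (by simpa using hcube1) (fun x y hx hy hr => ?_) hn1 hn2⟩
    · exact card_closure_of_cube (h := 3) (p := 3) (k := 1) (by norm_num) (by norm_num) (by decide)
        (hww 3) hS3 (fun j hj => mul_zpow_mul_of_cube (hww 3) (hcube j hj)) hn1 hn2
    · simp only [map_pow, map_mul, lift_letterW, lift_letterS] at hr
      exact hasRewriting_of_cube_relators (p := 3) (by decide)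
        (fun j hj => by simp only [Int.ModEq]; omega) hx hy hr
  · intro hv
    have hw3 : width N 3 = 3 := by
      rw [hwidth3, min_eq_left (by omega)]; rfl
    have hv0 : N.factorization 3 ≠ 0 := by omega
    have hS3 : S 3 ^ 3 = 1 := by have := hSw 3; rwa [hw3] at this
    have hcomm : Commute (w 3 * S 3 * w 3) (S 3) :=
      commute_conj_shiftClass (l := 3 ^ (N.factorization 3 - 3)) h3p hv0 (hW 3) (by
        rw [hw3]
        nth_rewrite 1 [show N.factorization 3 = (N.factorization 3 - 3) + 3 by omega]
        ring)
    have hn1 := hnf1 3 h3p hv0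
    have hn2 := hnf2 3 h3p hv0
    rw [hw3] at hn1
    refine ⟨hw2 3, hS3, hcomm,
      card_closure_of_commute (h := 3) (by norm_num) (hww 3) hS3 hcomm hn1 hn2,
      hasDefiningRelators_of_hasRewriting (h := 3) (hww 3) hS3 ?_ (fun x y hx _ hr => ?_) hn1 hn2⟩
    · simpa [map_commutatorElement, commutatorElement_eq_one_iff_commute] using hcomm
    · simp only [map_mul, map_commutatorElement, lift_letterW, lift_letterS,
        commutatorElement_eq_one_iff_commute] at hr
      exact .of_commute hx hr
  · intro hv
    exact hone 2 h2p (by rw [hwidth2]; simp [mu, hv]) (by change lam ≠ 0; omega)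
  · intro h1 h2 h3
    have hv0 : N.factorization 2 ≠ 0 := by change lam ≠ 0; omega
    have hS2 : S 2 ^ 2 ^ mu = 1 := by have := hSw 2; rwa [hwidth2] at this
    have hcube : ∀ j : ℤ, ¬ ((2 : ℕ) : ℤ) ∣ j → (w 2 * S 2 ^ j) ^ 3 = 1 := fun j hj =>
      atkinLehnerClass_mul_shiftClass_pow_three h2p hv0 (hW 2)
        (by rw [hwidth2, ← pow_add, ← two_mul, ← h1]) hj
    have hcube1 : (w 2 * S 2) ^ 3 = 1 := by simpa using hcube 1 (by decide)
    have hn1 := hnf1 2 h2p hv0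
    have hn2 := hnf2 2 h2p hv0
    rw [hwidth2] at hn1
    have hcard := fun k (hk : 2 ^ mu = 2 * k) =>
      card_closure_of_cube (h := 2 ^ mu) (p := 2) (k := k) (by positivity) hk (by decide)
        (hww 2) hS2 (fun j hj => mul_zpow_mul_of_cube (hww 2) (hcube j hj)) hn1 hn2
    refine ⟨hw2 2, hS2, hcube1, fun h => ?_, fun h => ?_, fun h => ?_, fun h =>
      hasDefiningRelators_of_hasRewriting (h := 2 ^ mu) (hww 2) hS2 (by simpa using hcube1)
        (fun x y hx hy hr => ?_) hn1 hn2⟩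
    · have hmu : mu = 1 := by omega
      rw [hmu] at hcard
      exact hcard 1 rfl
    · have hmu : mu = 2 := by omega
      rw [hmu] at hcard
      exact hcard 2 rfl
    · have hmu : mu = 3 := by omega
      rw [hmu] at hcard
      exact hcard 4 rfl
    · simp only [map_pow, map_mul, lift_letterW, lift_letterS] at hr
      refine hasRewriting_of_cube_relators (p := 2) (by decide) (fun j hj => ?_) hx hy hr
      have hmu : mu = 1 ∨ mu = 2 := by omega
      rcases hmu with hmu | hmu <;> rw [hmu] <;> simp only [Int.ModEq] <;> push_cast <;> omega
  · intro h1 h2 h3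
    have hv0 : N.factorization 2 ≠ 0 := by change lam ≠ 0; omega
    have hS2 : S 2 ^ 2 ^ mu = 1 := by have := hSw 2; rwa [hwidth2] at this
    have hlam : lam = 2 * mu + 1 := by omega
    have hfour : (w 2 * S 2) ^ 4 = 1 :=
      atkinLehnerClass_mul_shiftClass_pow_four h2p hv0 (hW 2) (by
        change 2 ^ lam = _
        rw [hwidth2, hlam]; ring)
    have hn1 := hnf1 2 h2p hv0
    have hn2 := hnf2 2 h2p hv0
    refine ⟨hw2 2, hS2, hfour, fun h => ?_⟩
    have hmu : mu = 1 := by omega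
    rw [hmu] at hS2
    rw [hwidth2, hmu] at hn1
    refine hasDefiningRelators_of_hasRewriting (h := 2) (hww 2) hS2 (by simpa using hfour)
      (fun x y hx hy hr => ?_) hn1 hn2
    simp only [map_pow, map_mul, lift_letterW, lift_letterS] at hr
    exact .of_commute hx (commute_of_pow_four hx (by rwa [← sq]) hr)
  · intro hv
    have hv0 : N.factorization 2 ≠ 0 := by change lam ≠ 0; omega
    have hmu : mu = 3 := by omega
    have hS2 : S 2 ^ 8 = 1 := by have := hSw 2; rwa [hwidth2, hmu] at this
    have hoct := octic_relation (hW 2) hv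
    have hn1 := hnf1 2 h2p hv0
    have hn2 := hnf2 2 h2p hv0
    rw [hwidth2, hmu] at hn1
    refine ⟨hw2 2, hS2, hoct, hasDefiningRelators_of_hasRewriting (h := 8) (hww 2) hS2
      (by simpa using hoct) (fun x y hx _ hr => ?_) hn1 hn2⟩
    simp only [map_pow, map_mul, lift_letterW, lift_letterS] at hr
    exact .of_order_eight hx hr
  · intro hv
    have hv0 : N.factorization 2 ≠ 0 := by change lam ≠ 0; omega
    have hmu : mu = 3 := by omega
    have hS2 : S 2 ^ 8 = 1 := by have := hSw 2; rwa [hwidth2, hmu] at this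
    have hcomm : Commute (w 2 * S 2 * w 2) (S 2) :=
      commute_conj_shiftClass (l := 2 ^ (lam - 9)) h2p hv0 (hW 2) (by
        rw [hwidth2, hmu, ← pow_add, ← pow_add, ← pow_add]; congr 1; change lam = _; omega)
    have hn1 := hnf1 2 h2p hv0
    have hn2 := hnf2 2 h2p hv0
    rw [hwidth2, hmu] at hn1
    refine ⟨hw2 2, hS2, hcomm.symm, hasDefiningRelators_of_hasRewriting (h := 8) (hww 2) hS2 ?_
      (fun x y hx _ hr => ?_) hn1 hn2⟩
    · simpa [map_commutatorElement, commutatorElement_eq_one_iff_commute] using hcomm.symm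
    · simp only [map_mul, map_commutatorElement, lift_letterW, lift_letterS,
        commutatorElement_eq_one_iff_commute] at hr
      exact .of_commute hx hr.symm
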